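/- **Problem 1-UF-CS** (uploading one model, unsplittable flow, utility-maximising client selection). An instance consists of $I$ satellites; $K\ge 1$ snapshots $1,\dots,K$, each a directed graph on the satellites whose arcs carry capacities in $\mathbb{Q}_{\ge 0}$ (a bidirectional link is a pair of opposite arcs, each with its own capacity); a server satellite $s$; a model size $q\in\mathbb{Q}_{>0}$; a set $\mathcal C$ of client satellites; and, for every $c\in\mathcal C$, a starting snapshot $\kappa_c\in\{1,\dots,K\}$ and a utility $u_c\in\mathbb{Q}$. The time-varying graph $\mathcal G$ of the instance has as nodes the copies $(i,k)$ of each satellite $i$ in each snapshot $k$, and as arcs the arcs of each snapshot between the copies in that snapshot, with their capacities, together with the caching arcs $(i,k)\to(i,k+1)$, $1\le k<K$, of capacity $q|\mathcal C|$. A feasible solution is a set $S\subseteq\mathcal C$ of selected clients together with, for each $c\in S$, a single directed simple path $P_c$ in $\mathcal G$ from $(c,\kappa_c)$ to $(s,K)$, such that for every arc $a$ of capacity $p_a$ we have $q\cdot|\{c\in S : a\in P_c\}|\le p_a$. It is optimal if it maximises $\sum_{c\in S}u_c$ over all feasible solutions. **Theorem.** 1-UF-CS is solvable in polynomial time: there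 are a single program for a deterministic random-access machine with logarithmic cost and a polynomial $p$ such that, on every instance, with all numbers written in binary and all nodes and arcs listed explicitly, the program halts with an optimal feasible solution (the selected clients and their paths) after a computation of cost at most $p(L)$, where $L$ is the bit length of the encoded instance. -/

import Mathlib

/-! # Random-access machines with logarithmic cost -/

namespace RAM

/-- The contents of the memory cells `0, 1, 2, …`, each holding a natural number. -/
abbrev Mem := ℕ → ℕ

/-- Arithmetic operations. Subtraction is truncated at `0`, division is rounded down. -/
inductive Op
  | add
  | sub
  | mul
  | div

def Op.eval : Op → ℕ → ℕ → ℕ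
  | .add, a, b => a + b
  | .sub, a, b => a - b
  | .mul, a, b => a * b
  | .div, a, b => a / b

/-- Expressions; `load e` is the content of the cell whose address is the value of `e`
(indirect addressing). -/
inductive Expr
  | const (n : ℕ)
  | load (e : Expr)
  | bin (o : Op) (e₁ e₂ : Expr)

def Expr.eval (m : Mem) : Expr → ℕ
  | .const n => n
  | .load e => m (e.eval m)
  | .bin o e₁ e₂ => o.eval (e₁.eval m) (e₂.eval m)

/-- Logarithmic cost: every operation is charged the total bit length of its operands, a memory
access the bit lengths of the address and of the content. -/
def Expr.cost (m : Mem) : Expr → ℕ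
  | .const n => n.size + 1
  | .load e => e.cost m + (e.eval m).size + (m (e.eval m)).size + 1
  | .bin _ e₁ e₂ => e₁.cost m + e₂.cost m + (e₁.eval m).size + (e₂.eval m).size + 1

/-- Programs. `store a e` writes the value of `e` into the cell whose address is the value of `a`;
`ite` and `while` branch on whether a value is nonzero. -/
inductive Prog
  | skip
  | store (a e : Expr)
  | seq (P Q : Prog)
  | ite (e : Expr) (P Q : Prog)
  | while (e : Expr) (P : Prog)

/-- `Run P m m' t`: the program `P`, started with memory `m`, halts with memory `m'`,
and the total logarithmic cost of all executed operations is `t`. -/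
inductive Run : Prog → Mem → Mem → ℕ → Prop
  | skip (m : Mem) : Run .skip m m 1
  | store (a e : Expr) (m : Mem) :
      Run (.store a e) m (Function.update m (a.eval m) (e.eval m))
        (a.cost m + e.cost m + (a.eval m).size + (e.eval m).size + 1)
  | seq {P Q : Prog} {m₁ m₂ m₃ : Mem} {t₁ t₂ : ℕ}
      (hP : Run P m₁ m₂ t₁) (hQ : Run Q m₂ m₃ t₂) :
      Run (.seq P Q) m₁ m₃ (t₁ + t₂)
  | ite_true {e : Expr} {P Q : Prog} {m m' : Mem} {t : ℕ}
      (he : e.eval m ≠ 0) (hP : Run P m m' t) :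
      Run (.ite e P Q) m m' (e.cost m + (e.eval m).size + 1 + t)
  | ite_false {e : Expr} {P Q : Prog} {m m' : Mem} {t : ℕ}
      (he : e.eval m = 0) (hQ : Run Q m m' t) :
      Run (.ite e P Q) m m' (e.cost m + (e.eval m).size + 1 + t)
  | while_false {e : Expr} {P : Prog} {m : Mem} (he : e.eval m = 0) :
      Run (.while e P) m m (e.cost m + (e.eval m).size + 1)
  | while_true {e : Expr} {P : Prog} {m₁ m₂ m₃ : Mem} {t₁ t₂ : ℕ}
      (he : e.eval m₁ ≠ 0) (hP : Run P m₁ m₂ t₁) (hW : Run (.while e P) m₂ m₃ t₂) :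
      Run (.while e P) m₁ m₃ (e.cost m₁ + (e.eval m₁).size + 1 + t₁ + t₂)

/-- The machine is deterministic: the final memory and the cost of a halting run are unique. -/
theorem Run.deterministic {P : Prog} {m m₁ m₂ : Mem} {t₁ t₂ : ℕ}
    (h₁ : Run P m m₁ t₁) (h₂ : Run P m m₂ t₂) : m₁ = m₂ ∧ t₁ = t₂ := by
  induction h₁ generalizing m₂ t₂ with
  | skip m => cases h₂; exact ⟨rfl, rfl⟩
  | store a e m => cases h₂; exact ⟨rfl, rfl⟩
  | seq _ _ ihP ihQ =>
    cases h₂ with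
    | seq hP hQ =>
      obtain ⟨rfl, rfl⟩ := ihP hP
      obtain ⟨rfl, rfl⟩ := ihQ hQ
      exact ⟨rfl, rfl⟩
  | ite_true he _ ih =>
    cases h₂ with
    | ite_true _ hP => obtain ⟨rfl, rfl⟩ := ih hP; exact ⟨rfl, rfl⟩
    | ite_false he' _ => exact absurd he' he
  | ite_false he _ ih =>
    cases h₂ with
    | ite_true he' _ => exact absurd he he'
    | ite_false _ hQ => obtain ⟨rfl, rfl⟩ := ih hQ; exact ⟨rfl, rfl⟩
  | while_false he =>
    cases h₂ with
    | while_false _ => exact ⟨rfl, rfl⟩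
    | while_true he' _ _ => exact absurd he he'
  | while_true he _ _ ihP ihW =>
    cases h₂ with
    | while_false he' => exact absurd he' he
    | while_true _ hP hW =>
      obtain ⟨rfl, rfl⟩ := ihP hP
      obtain ⟨rfl, rfl⟩ := ihW hW
      exact ⟨rfl, rfl⟩

/-- Initial memory for the input word `l`: cell `0` holds the length of `l`, the following cells
its entries, all other cells `0`. -/
def inputMem (l : List ℕ) : Mem
  | 0 => l.length
  | i + 1 => l.getD i 0

/-- The length of the input in bits (one separator per entry). -/
def bitLength (l : List ℕ) : ℕ := (l.map fun n => n.size + 1).sum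

/-- The output word `l` is read off in the same format in which inputs are supplied. -/
def HasOutput (m : Mem) (l : List ℕ) : Prop :=
  m 0 = l.length ∧ ∀ (i : ℕ) (h : i < l.length), m (i + 1) = l[i]

/-- A search problem assigns to every instance `x : X` a type `Y x` of candidate answers and a
predicate `IsAnswer x` singling out the correct ones. It is solvable in polynomial time if one
program, on the encoding of each instance, halts with the encoding of a correct answer at a cost
bounded by a fixed polynomial in the bit length of the encoded instance. -/
def PolyTimeSolvable {X : Type} {Y : X → Type} (encodeIn : X → List ℕ)
    (encodeOut : (x : X) → Y x → List ℕ) (IsAnswer : (x : X) → Y x → Prop) : Prop :=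
  ∃ (P : Prog) (p : Polynomial ℕ), ∀ x : X, ∃ y : Y x, IsAnswer x y ∧
    ∃ (m : Mem) (t : ℕ), Run P (inputMem (encodeIn x)) m t ∧
      t ≤ p.eval (bitLength (encodeIn x)) ∧ HasOutput m (encodeOut x y)

end RAM

/-! # Uploading one model with unsplittable flow and client selection -/

namespace UFCS

/-- An instance of 1-UF-CS. Numerical data are rational, as usual for exact computation. -/
structure Instance where
  /-- number of satellites -/
  I : ℕ
  /-- number of snapshots -/
  K : ℕ
  K_pos : 0 < K
  /-- `cap k i j` is the capacity of the intra-snapshot arc from satellite `i` to satellite `j` in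
  snapshot `k`, and `none` if there is no such arc. A bidirectional link is a pair of opposite
  arcs, which may have different capacities. -/
  cap : Fin K → Fin I → Fin I → Option ℚ≥0
  /-- the server satellite -/
  s : Fin I
  /-- the model size -/
  q : ℚ≥0
  q_pos : 0 < q
  /-- the clients -/
  C : Finset (Fin I)
  /-- the earliest snapshot from which the routing for a client can begin -/
  κ : {c // c ∈ C} → Fin K
  /-- the utilities of the clients -/
  u : {c // c ∈ C} → ℚ

namespace Instance

variable (G : Instance)

abbrev Client : Type := {c // c ∈ G.C}

/-- Nodes of the time-varying graph: `(i, k)` is the copy of satellite `i` in snapshot `k`.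
Snapshots are numbered `0, …, K - 1`. -/
abbrev Node : Type := Fin G.I × Fin G.K

/-- The node from which the model of client `c` is routed. -/
def source (c : G.Client) : G.Node := (c.1, G.κ c)

/-- The copy of the server in the last snapshot. -/
def sink : G.Node := (G.s, ⟨G.K - 1, Nat.sub_lt G.K_pos Nat.one_pos⟩)

/-- The capacity of the arc `(v, w)` of the time-varying graph, `none` if there is no such arc.
The inter-snapshot (caching) arcs join the copies of a satellite in consecutive snapshots, and
their capacity `q * |C|` suffices for all models. -/
def arcCap (v w : G.Node) : Option ℚ≥0 :=
  if v.2 = w.2 then G.cap v.2 v.1 w.1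
  else if v.1 = w.1 ∧ v.2.val + 1 = w.2.val then some (G.q * (G.C.card : ℚ≥0))
  else none

def IsArc (v w : G.Node) : Prop := (G.arcCap v w).isSome

/-- `P` lists the nodes of a directed (simple) path from `v` to `w`. -/
def IsPath (v w : G.Node) (P : List G.Node) : Prop :=
  P.head? = some v ∧ P.getLast? = some w ∧ P.Nodup ∧ P.IsChain G.IsArc

/-- A client selection with unsplittable routing: `R c` is the single path carrying the whole model
of `c` if client `c` is selected, and `none` if it is not. -/
abbrev Routing : Type := G.Client → Option (List G.Node)

/-- The number of selected clients whose path uses the arc `(v, w)`. -/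
def usage (R : G.Routing) (v w : G.Node) : ℕ :=
  (Finset.univ.filter fun c : G.Client => ∃ P ∈ R c, [v, w] <:+: P).card

/-- Every selected model is delivered to the server by the last snapshot, and the total amount of
data on an arc does not exceed its capacity. -/
def Feasible (R : G.Routing) : Prop :=
  (∀ c, ∀ P ∈ R c, G.IsPath (G.source c) G.sink P) ∧
  ∀ v w, ∀ p ∈ G.arcCap v w, G.q * (G.usage R v w : ℚ≥0) ≤ p

/-- The total utility of the selected clients. -/
def utility (R : G.Routing) : ℚ := ∑ c : G.Client, if (R c).isSome then G.u c else 0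

/-- Feasible, and of maximum total utility among all feasible client selections with routing. -/
def Optimal (R : G.Routing) : Prop :=
  G.Feasible R ∧ ∀ R' : G.Routing, G.Feasible R' → G.utility R' ≤ G.utility R

/-- The instance as a word of natural numbers: satellite and snapshot counts, server, model size;
for all `k, i, j` whether the arc exists and its capacity; for every satellite whether it is a
client, and then its starting snapshot and utility (sign, numerator, denominator). -/
def encode : List ℕ :=
  [G.I, G.K, G.s.val, G.q.num, G.q.den] ++
  ((List.finRange G.K).flatMap fun k => (List.finRange G.I).flatMap fun i =>
    (List.finRange G.I).flatMap fun j =>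
      match G.cap k i j with
      | none => [0, 0, 1]
      | some p => [1, p.num, p.den]) ++
  ((List.finRange G.I).flatMap fun i =>
    if h : i ∈ G.C then
      [1, (G.κ ⟨i, h⟩).val, if G.u ⟨i, h⟩ < 0 then 1 else 0,
        (G.u ⟨i, h⟩).num.natAbs, (G.u ⟨i, h⟩).den]
    else [0, 0, 0, 0, 1])

/-- A client selection with routing as a word of natural numbers: for each client, in increasing
order of satellite indices, `0` if it is not selected, and otherwise `1`, the number of nodes of its
path, and these nodes in order, each as a pair (satellite, snapshot). -/
def encodeRouting (R : G.Routing) : List ℕ :=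
  (List.finRange G.I).flatMap fun i =>
    if h : i ∈ G.C then
      match R ⟨i, h⟩ with
      | none => [0]
      | some P => 1 :: P.length :: P.flatMap fun v => [v.1.val, v.2.val]
    else []

end Instance

end UFCS

/-! # A loop language compiled to random-access machines in polynomial time -/

namespace RAM

/-! All models have the same size, so an arc of capacity `p` carries exactly `⌊p / q⌋` of them, and
an unsplittable routing is an integral flow with one unit per selected client and one common sink.
The client sets that can be routed form a matroid (a gammoid), so a greedy selection in order of
decreasing positive utility is optimal. Each client is tested by searching for an augmenting path,
and no accepted client is ever dropped.

The proof uses no matroid theory. The state `Greedy` carries a set `X` that misses the sink,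
contains every rejected source and is left by no residual arc. Counting flow across `X` shows that
among the clients considered so far no set respecting the cut condition has more elements than the
accepted set (`card_le_of_closed`). As this holds after every step, a summation by parts over
decreasing utilities compares total utilities (`Greedy.step`, `Greedy.sum_le`). Feasible routings
respect all cuts because every path crosses them (`Feasible.cutCond`). Conversely, the final flow is
split into simple paths, one per accepted client, by walking down a search tree of its support
(`Peel.step`). Circulations may be left over and do no harm.

The running time is handled once and for all. In the loop language every loop runs as often as the
input has entries, so a fixed program executes polynomially many instructions. A tame assignment
raises the largest stored value by at most a constant, so bit lengths stay polynomial as well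
(`Cmd.exists_run`). For a concrete solver there remain a syntactic check (`solver_tame`), the
correctness of its result (`solver_correct`), and a bound on the output length. -/

theorem Expr.exists_size_le (e : Expr) : ∃ C : ℕ, ∀ (m : Mem) (s : ℕ), (∀ a, (m a).size ≤ s) →
    (e.eval m).size ≤ C * (s + 1) ∧ e.cost m ≤ C * (s + 1) := by
  induction e with
  | const n =>
    refine ⟨n.size + 1, fun m s _ => ⟨?_, ?_⟩⟩ <;> simp only [Expr.eval, Expr.cost] <;> nlinarith
  | load e ih =>
    obtain ⟨C, h⟩ := ih
    refine ⟨2 * C + 2, fun m s hs => ⟨?_, ?_⟩⟩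
    · have := hs (e.eval m)
      simp only [Expr.eval]; nlinarith
    · have := hs (e.eval m)
      have := h m s hs
      simp only [Expr.cost]; nlinarith
  | bin o e₁ e₂ ih₁ ih₂ =>
    obtain ⟨C, h₁⟩ := ih₁
    obtain ⟨D, h₂⟩ := ih₂
    refine ⟨2 * C + 2 * D + 1, fun m s hs => ?_⟩
    obtain ⟨a₁, b₁⟩ := h₁ m s hs
    obtain ⟨a₂, b₂⟩ := h₂ m s hs
    refine ⟨?_, ?_⟩
    · have key : (o.eval (e₁.eval m) (e₂.eval m)).size ≤
          (e₁.eval m).size + (e₂.eval m).size + 1 := by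
        have l₁ := Nat.lt_size_self (e₁.eval m)
        have l₂ := Nat.lt_size_self (e₂.eval m)
        generalize e₁.eval m = x at *
        generalize e₂.eval m = y at *
        cases o <;> simp only [Op.eval]
        · rw [Nat.size_le, pow_succ, pow_add]
          have := Nat.one_le_two_pow (n := x.size)
          have := Nat.one_le_two_pow (n := y.size)
          nlinarith
        · have := Nat.size_le_size (Nat.sub_le x y); lia
        · rw [Nat.size_le, pow_succ, pow_add]
          have : x * y ≤ 2 ^ x.size * 2 ^ y.size := Nat.mul_le_mul l₁.le l₂.le
          have : 0 < 2 ^ x.size * 2 ^ y.size := by positivity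
          lia
        · have := Nat.size_le_size (Nat.div_le_self x y); lia
      simp only [Expr.eval]; nlinarith
    · simp only [Expr.cost]; nlinarith

theorem polynomial_eval_mono (p : Polynomial ℕ) {a b : ℕ} (h : a ≤ b) :
    p.eval a ≤ p.eval b := by
  rw [Polynomial.eval_eq_sum_range, Polynomial.eval_eq_sum_range]
  gcongr

/-- Crude in `b`, but sufficient: `b` will be a polynomial growth of cell values, while `a` may be
exponential in the input length. -/
theorem size_add_le (a b : ℕ) : (a + b).size ≤ a.size + b := by
  rw [Nat.size_le, pow_add]
  have h₁ := Nat.lt_size_self a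
  have h₂ : b < 2 ^ b := Nat.lt_two_pow_self
  have : 1 ≤ 2 ^ a.size := Nat.one_le_two_pow
  nlinarith

/-- An injective pairing given by a polynomial. -/
def sqPair (a b : ℕ) : ℕ := (a + b) * (a + b) + a

/-- The value lies between the consecutive squares of `a + b` and `a + b + 1`, which determines the
sum and then `a`. -/
theorem sqPair_inj {a b c d : ℕ} : sqPair a b = sqPair c d ↔ a = c ∧ b = d := by
  refine ⟨fun h => ?_, fun ⟨h₁, h₂⟩ => by rw [h₁, h₂]⟩
  unfold sqPair at h
  have : a + b = c + d := by
    rcases lt_trichotomy (a + b) (c + d) with h' | h' | h'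
    · nlinarith
    · exact h'
    · nlinarith
  rw [this] at h
  lia

/-! ### Syntax, semantics and tameness of the loop language -/

/-- The working store: a value for every array name and every pair of indices. -/
abbrev Store := ℕ → ℕ → ℕ → ℕ

def Store.set (σ : Store) (t i j v : ℕ) : Store :=
  fun t' i' j' => if t' = t ∧ i' = i ∧ j' = j then v else σ t' i' j'

/-- Terms of the loop language. -/
inductive Term
  | const (n : ℕ)
  | len
  | inp (e : Term)
  | cell (t : ℕ) (i j : Term)
  | bin (o : Op) (a b : Term)

def Term.eval (l : List ℕ) (σ : Store) : Term → ℕ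
  | .const n => n
  | .len => l.length
  | .inp e => l.getD (e.eval l σ) 0
  | .cell t i j => σ t (i.eval l σ) (j.eval l σ)
  | .bin o a b => o.eval (a.eval l σ) (b.eval l σ)

def Term.isConst : Term → Bool
  | .const _ => true
  | _ => false

/-- A tame term exceeds the values stored so far by at most a constant. -/
def Term.tame : Term → Bool
  | .bin .add a b => a.tame && b.isConst
  | .bin .mul _ _ => false
  | .bin _ a _ => a.tame
  | _ => true

/-- Commands of the loop language. A loop runs as often as the input word has entries. -/
inductive Cmd
  | skip
  | assign (t : ℕ) (i j e : Term)
  | seq (c d : Cmd)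
  | ite (e : Term) (c d : Cmd)
  | loop (x : ℕ) (c : Cmd)

/-- `iter n f σ` is `f (n - 1) (… (f 0 σ))`. -/
def iter {α : Type} (n : ℕ) (f : ℕ → α → α) (a : α) : α :=
  Nat.rec a f n

theorem iter_induction {α : Type} {f : ℕ → α → α} {a : α} (P : ℕ → α → Prop) (n : ℕ)
    (h₀ : P 0 a) (h : ∀ i b, i < n → P i b → P (i + 1) (f i b)) : P n (iter n f a) := by
  induction n with
  | zero => exact h₀
  | succ n ih => exact h _ _ n.lt_succ_self (ih fun i b hi => h i b (hi.trans n.lt_succ_self))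

/-- The body receives the counter in a cell but cannot change the number of iterations by
overwriting it. Nested loops may therefore share a variable, as `greedy` and the searches inside it
share `aRound`. -/
def Cmd.exec (l : List ℕ) : Cmd → Store → Store
  | .skip, σ => σ
  | .assign t i j e, σ => σ.set t (i.eval l σ) (j.eval l σ) (e.eval l σ)
  | .seq c d, σ => d.exec l (c.exec l σ)
  | .ite e c d, σ => if e.eval l σ ≠ 0 then c.exec l σ else d.exec l σ
  | .loop x c, σ => iter l.length (fun k τ => c.exec l (τ.set x 0 0 k)) σ

def Cmd.tame : Cmd → Bool
  | .skip => true
  | .assign _ _ _ e => e.tame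
  | .seq c d => c.tame && d.tame
  | .ite _ c d => c.tame && d.tame
  | .loop _ c => c.tame

/-- The arrays a command may write to. -/
def Cmd.writes : Cmd → List ℕ
  | .skip => []
  | .assign t _ _ _ => [t]
  | .seq c d => c.writes ++ d.writes
  | .ite _ c d => c.writes ++ d.writes
  | .loop x c => x :: c.writes

theorem Store.set_of_ne (σ : Store) {t t' : ℕ} (h : t' ≠ t) (i j v : ℕ) :
    σ.set t i j v t' = σ t' := by
  funext i' j'; simp [Store.set, h]

/-- Frame rule: it carries facts about untouched arrays through program fragments. -/
theorem Cmd.exec_of_notMem (c : Cmd) (l : List ℕ) (σ : Store) {t : ℕ} (h : t ∉ c.writes) :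
    c.exec l σ t = σ t := by
  induction c generalizing σ with
  | skip => rfl
  | assign t' i j e =>
    simp only [Cmd.writes, List.mem_singleton] at h
    exact Store.set_of_ne _ h _ _ _
  | seq c d ihc ihd =>
    simp only [Cmd.writes, List.mem_append, not_or] at h
    simp only [Cmd.exec]
    rw [ihd _ h.2, ihc _ h.1]
  | ite e c d ihc ihd =>
    simp only [Cmd.writes, List.mem_append, not_or] at h
    simp only [Cmd.exec]
    split
    · exact ihc _ h.1
    · exact ihd _ h.2
  | loop x c ih =>
    simp only [Cmd.writes, List.mem_cons, not_or] at h
    refine iter_induction (fun _ (τ : Store) => τ t = σ t) _ rfl fun k τ _ hτ => ?_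
    rw [ih _ h.2, Store.set_of_ne _ h.1, hτ]

/-! ## Compilation -/

/-- The input occupies the addresses `0` to `n`. Beyond it, odd offsets from `n` hold the store and
even ones the loop counters, so parity separates them. -/
def cellAddr (n t i j : ℕ) : ℕ := n + 1 + 2 * sqPair t (sqPair i j)

/-- The address of the counter of a loop at nesting depth `d`. -/
def counterAddr (n d : ℕ) : ℕ := n + 2 + 2 * d

def lenExpr : Expr := .load (.const 0)

def pairExpr (a b : Expr) : Expr :=
  .bin .add (.bin .mul (.bin .add a b) (.bin .add a b)) a

def addrExpr (t : ℕ) (i j : Expr) : Expr :=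
  .bin .add (.bin .add lenExpr (.const 1))
    (.bin .mul (.const 2) (pairExpr (.const t) (pairExpr i j)))

def counterExpr (d : ℕ) : Expr := .bin .add lenExpr (.const (2 + 2 * d))

/-- Beyond the input lie cells of the store, whereas `inp` must read `0` there. The first factor in
that case is `1` for an index within the input and `0` otherwise. -/
def Term.toExpr : Term → Expr
  | .const n => .const n
  | .len => lenExpr
  | .inp e => .bin .mul
      (.bin .sub (.const 1) (.bin .sub (.bin .add e.toExpr (.const 1)) lenExpr))
      (.load (.bin .add e.toExpr (.const 1)))
  | .cell t i j => .load (addrExpr t i.toExpr j.toExpr)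
  | .bin o a b => .bin o a.toExpr b.toExpr

/-- The second argument is the nesting depth, which gives each enclosing loop a counter of its own.
Consecutive loops at equal depth reuse theirs after a reset. -/
def Cmd.compile : Cmd → ℕ → Prog
  | .skip, _ => .skip
  | .assign t i j e, _ => .store (addrExpr t i.toExpr j.toExpr) e.toExpr
  | .seq c d, k => .seq (c.compile k) (d.compile k)
  | .ite e c d, k => .ite e.toExpr (c.compile k) (d.compile k)
  | .loop x c, k => .seq (.store (counterExpr k) (.const 0))
      (.while (.bin .sub lenExpr (.load (counterExpr k)))
        (.seq (.store (addrExpr x (.const 0) (.const 0)) (.load (counterExpr k)))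
          (.seq (c.compile (k + 1))
            (.store (counterExpr k) (.bin .add (.load (counterExpr k)) (.const 1))))))

/-- The memory `m` represents the input word `l` and the store `σ`. -/
structure Rep (l : List ℕ) (m : Mem) (σ : Store) : Prop where
  len : m 0 = l.length
  inp : ∀ i < l.length, m (i + 1) = l.getD i 0
  cell : ∀ t i j, m (cellAddr l.length t i j) = σ t i j

theorem Rep.update_cell {l m σ} (h : Rep l m σ) (t i j v : ℕ) :
    Rep l (Function.update m (cellAddr l.length t i j) v) (σ.set t i j v) where
  len := by
    rw [Function.update_of_ne (by unfold cellAddr; lia), h.len]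
  inp k hk := by
    rw [Function.update_of_ne (by unfold cellAddr; lia), h.inp k hk]
  cell t' i' j' := by
    have : cellAddr l.length t' i' j' = cellAddr l.length t i j ↔ t' = t ∧ i' = i ∧ j' = j := by
      unfold cellAddr
      rw [← sqPair_inj (a := i'), ← sqPair_inj]
      lia
    rw [Function.update_apply, Store.set]
    simp only [this, h.cell]

theorem Rep.update_counter {l m σ} (h : Rep l m σ) (d v : ℕ) :
    Rep l (Function.update m (counterAddr l.length d) v) σ where
  len := by
    rw [Function.update_of_ne (by unfold counterAddr; lia), h.len]
  inp k hk := by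
    rw [Function.update_of_ne (by unfold counterAddr; lia), h.inp k hk]
  cell t' i' j' := by
    rw [Function.update_of_ne (by unfold counterAddr cellAddr; lia), h.cell]

theorem addrExpr_eval {m : Mem} {n : ℕ} (h : m 0 = n) (t : ℕ) (i j : Expr) :
    (addrExpr t i j).eval m = cellAddr n t (i.eval m) (j.eval m) := by
  simp [addrExpr, pairExpr, lenExpr, Expr.eval, Op.eval, h, cellAddr, sqPair]

theorem counterExpr_eval {m : Mem} {n : ℕ} (h : m 0 = n) (d : ℕ) :
    (counterExpr d).eval m = counterAddr n d := by
  simp [counterExpr, lenExpr, Expr.eval, Op.eval, h, counterAddr, add_assoc]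

theorem Rep.toExpr_eval {l m σ} (h : Rep l m σ) (e : Term) : e.toExpr.eval m = e.eval l σ := by
  induction e with
  | const n => rfl
  | len => simpa [Term.toExpr, lenExpr, Expr.eval, Term.eval] using h.len
  | inp e ih =>
    simp only [Term.toExpr, lenExpr, Expr.eval, Op.eval, ih, h.len, Term.eval]
    by_cases hi : e.eval l σ < l.length
    · rw [h.inp _ hi]
      have : 1 - (e.eval l σ + 1 - l.length) = 1 := by lia
      rw [this, one_mul]
    · have : 1 - (e.eval l σ + 1 - l.length) = 0 := by lia
      rw [this, zero_mul, List.getD_eq_default _ _ (by lia)]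
  | cell t i j ihi ihj =>
    simp only [Term.toExpr, Expr.eval, addrExpr_eval h.len, ihi, ihj, Term.eval, h.cell]
  | bin o a b iha ihb => simp only [Term.toExpr, Expr.eval, iha, ihb, Term.eval]

/-- Indices, and second operands of subtraction and division, may be arbitrary: a read yields a
stored value or `0`, and these two operations never exceed their first operand. -/
theorem Rep.exists_eval_le (e : Term) (he : e.tame) : ∃ g : ℕ, ∀ l m σ B, Rep l m σ →
    (∀ a, m a ≤ B) → e.eval l σ ≤ B + g := by
  induction e with
  | const n => exact ⟨n, fun l m σ B _ _ => by simp [Term.eval]⟩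
  | len => exact ⟨0, fun l m σ B h hB => by simpa [Term.eval, h.len] using hB 0⟩
  | inp e ih =>
    refine ⟨0, fun l m σ B h hB => ?_⟩
    simp only [Term.eval]
    by_cases hi : e.eval l σ < l.length
    · rw [← h.inp _ hi]; exact hB _
    · rw [List.getD_eq_default _ _ (by lia)]; exact Nat.zero_le _
  | cell t i j =>
    exact ⟨0, fun l m σ B h hB => by
      simpa [Term.eval, h.cell] using hB (cellAddr l.length t (i.eval l σ) (j.eval l σ))⟩
  | bin o a b iha ihb =>
    cases o with
    | add =>
      cases b with
      | const c =>
        obtain ⟨g, hg⟩ := iha (by simpa [Term.tame, Term.isConst] using he)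
        refine ⟨g + c, fun l m σ B h hB => ?_⟩
        have := hg l m σ B h hB
        simp only [Term.eval, Op.eval]; lia
      | _ => simp [Term.tame, Term.isConst] at he
    | sub =>
      obtain ⟨g, hg⟩ := iha he
      exact ⟨g, fun l m σ B h hB => (Nat.sub_le _ _).trans (hg l m σ B h hB)⟩
    | mul => simp [Term.tame] at he
    | div =>
      obtain ⟨g, hg⟩ := iha he
      exact ⟨g, fun l m σ B h hB => (Nat.div_le_self _ _).trans (hg l m σ B h hB)⟩

theorem exists_run_store (a e : Expr) : ∃ C : ℕ, ∀ (m : Mem) (B : ℕ), (∀ x, m x ≤ B) →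
    ∃ t ≤ C * (B.size + 1),
      Run (.store a e) m (Function.update m (a.eval m) (e.eval m)) t := by
  obtain ⟨C, hC⟩ := a.exists_size_le
  obtain ⟨D, hD⟩ := e.exists_size_le
  refine ⟨2 * C + 2 * D + 1, fun m B hB => ⟨_, ?_, Run.store a e m⟩⟩
  obtain ⟨h₁, h₂⟩ := hC m B.size fun x => Nat.size_le_size (hB x)
  obtain ⟨h₃, h₄⟩ := hD m B.size fun x => Nat.size_le_size (hB x)
  nlinarith

theorem update_le {m : Mem} {B a v : ℕ} (hm : ∀ x, m x ≤ B) (hv : v ≤ B) (x : ℕ) :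
    Function.update m a v x ≤ B := by
  rw [Function.update_apply]; split
  · exact hv
  · exact hm x

/-- A compiled command computes the result of the command in polynomial time and changes
no counter of an enclosing loop. -/
theorem Cmd.exists_run (c : Cmd) (hc : c.tame) (d : ℕ) : ∃ g p : Polynomial ℕ,
    ∀ l m σ B, Rep l m σ → (∀ a, m a ≤ B) → ∃ m' t, Run (c.compile d) m m' t ∧
      Rep l m' (c.exec l σ) ∧ (∀ a, m' a ≤ B + g.eval l.length) ∧
      (∀ k < d, m' (counterAddr l.length k) = m (counterAddr l.length k)) ∧
      t ≤ p.eval (l.length + B.size) := by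
  induction c generalizing d with
  | skip =>
    exact ⟨0, 1, fun l m σ B h hB => ⟨m, 1, Run.skip m, h, by simpa using hB, fun _ _ => rfl,
      by simp⟩⟩
  | assign t i j e =>
    obtain ⟨g, hg⟩ := Rep.exists_eval_le e hc
    obtain ⟨C, hC⟩ := exists_run_store (addrExpr t i.toExpr j.toExpr) e.toExpr
    refine ⟨(g : Polynomial ℕ), (C : Polynomial ℕ) * (Polynomial.X + 1), fun l m σ B h hB => ?_⟩
    obtain ⟨t', ht', hr⟩ := hC m B hB
    have hb := hg l m σ B h hB
    rw [addrExpr_eval h.len, h.toExpr_eval, h.toExpr_eval, h.toExpr_eval] at hr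
    refine ⟨_, t', hr, h.update_cell _ _ _ _, ?_, fun k _ => ?_, ?_⟩
    · simp only [Polynomial.eval_natCast, Nat.cast_id]
      exact update_le (fun x => (hB x).trans (Nat.le_add_right _ _)) hb
    · rw [Function.update_of_ne (by unfold counterAddr cellAddr; lia)]
    · simp only [Polynomial.eval_mul, Polynomial.eval_natCast, Polynomial.eval_add,
        Polynomial.eval_X, Polynomial.eval_one, Nat.cast_id]
      refine ht'.trans (Nat.mul_le_mul_left _ ?_)
      lia
  | seq c₁ c₂ ih₁ ih₂ =>
    simp only [Cmd.tame, Bool.and_eq_true] at hc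
    obtain ⟨g₁, p₁, H₁⟩ := ih₁ hc.1 d
    obtain ⟨g₂, p₂, H₂⟩ := ih₂ hc.2 d
    -- The second command starts from cells bounded by `B + g₁`, whose bit length exceeds that of
    -- `B` by at most `g₁`.
    refine ⟨g₁ + g₂, p₁ + p₂.comp (Polynomial.X + g₁), fun l m σ B h hB => ?_⟩
    obtain ⟨m₁, t₁, r₁, h₁, hB₁, hk₁, ht₁⟩ := H₁ l m σ B h hB
    obtain ⟨m₂, t₂, r₂, h₂, hB₂, hk₂, ht₂⟩ := H₂ l m₁ _ _ h₁ hB₁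
    refine ⟨m₂, _, r₁.seq r₂, h₂, ?_, fun k hk => (hk₂ k hk).trans (hk₁ k hk), ?_⟩
    · simpa [add_assoc] using hB₂
    · simp only [Polynomial.eval_add, Polynomial.eval_comp, Polynomial.eval_X]
      refine Nat.add_le_add ht₁ (ht₂.trans (polynomial_eval_mono _ ?_))
      have := size_add_le B (g₁.eval l.length)
      have := polynomial_eval_mono g₁ (Nat.le_add_right l.length B.size)
      lia
  | ite e c₁ c₂ ih₁ ih₂ =>
    simp only [Cmd.tame, Bool.and_eq_true] at hc
    obtain ⟨g₁, p₁, H₁⟩ := ih₁ hc.1 d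
    obtain ⟨g₂, p₂, H₂⟩ := ih₂ hc.2 d
    obtain ⟨C, hC⟩ := e.toExpr.exists_size_le
    refine ⟨g₁ + g₂, ((2 * C + 1 : ℕ) : Polynomial ℕ) * (Polynomial.X + 1) + (p₁ + p₂), fun l m σ B h hB => ?_⟩
    obtain ⟨hs₁, hs₂⟩ := hC m B.size fun a => Nat.size_le_size (hB a)
    have hcost : e.toExpr.cost m + (e.toExpr.eval m).size + 1 ≤
        (2 * C + 1) * (l.length + B.size + 1) := by nlinarith
    by_cases he : e.eval l σ ≠ 0
    · obtain ⟨m₁, t₁, r₁, h₁, hB₁, hk₁, ht₁⟩ := H₁ l m σ B h hB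
      refine ⟨m₁, _, Run.ite_true (by rwa [h.toExpr_eval]) r₁, ?_, fun a => ?_, hk₁, ?_⟩
      · simpa only [Cmd.exec, if_pos he] using h₁
      · have := hB₁ a
        simp only [Polynomial.eval_add]; lia
      · simp only [Polynomial.eval_add, Polynomial.eval_mul, Polynomial.eval_natCast,
          Polynomial.eval_X, Polynomial.eval_one, Nat.cast_id]
        lia
    · obtain ⟨m₁, t₁, r₁, h₁, hB₁, hk₁, ht₁⟩ := H₂ l m σ B h hB
      refine ⟨m₁, _, Run.ite_false (by rw [h.toExpr_eval]; exact not_not.1 he) r₁, ?_,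
        fun a => ?_, hk₁, ?_⟩
      · simpa only [Cmd.exec, if_neg he] using h₁
      · have := hB₁ a
        simp only [Polynomial.eval_add]; lia
      · simp only [Polynomial.eval_add, Polynomial.eval_mul, Polynomial.eval_natCast,
          Polynomial.eval_X, Polynomial.eval_one, Nat.cast_id]
        lia
  | loop x c ih =>
    obtain ⟨g, p, H⟩ := ih hc (d + 1)
    obtain ⟨C₀, hC₀⟩ := exists_run_store (counterExpr d) (.const 0)
    obtain ⟨C₁, hC₁⟩ := exists_run_store (addrExpr x (.const 0) (.const 0)) (.load (counterExpr d))
    obtain ⟨C₂, hC₂⟩ := exists_run_store (counterExpr d)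
      (.bin .add (.load (counterExpr d)) (.const 1))
    obtain ⟨C₃, hC₃⟩ := (Expr.bin .sub lenExpr (.load (counterExpr d))).exists_size_le
    -- After `i ≤ n` iterations the cells are bounded by `B + i * G`; `q` dominates `n` plus the
    -- size of this bound. Then `w` bounds the cost of one iteration, and the factor `X + 2` covers
    -- `n` iterations, the failing test and the initialisation.
    let q : Polynomial ℕ := Polynomial.X + Polynomial.X * g
    let C := C₀ + C₁ + C₂ + 2 * C₃ + 1
    let w : Polynomial ℕ := (C : Polynomial ℕ) * (q + 1) + p.comp q
    refine ⟨Polynomial.X * g, (Polynomial.X + 2) * w, fun l m σ B h hB => ?_⟩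
    obtain ⟨t₀, ht₀, r₀⟩ := hC₀ m B hB
    rw [counterExpr_eval h.len] at r₀
    set n := l.length with hn
    set G := g.eval n
    let W := w.eval (n + B.size)
    -- Cell `0` contains `n`, so `B` also dominates the counter values written below.
    have hlen : n ≤ B := by rw [hn, ← h.len]; exact hB 0
    have hsz : ∀ i ≤ n, n + (B + i * G).size ≤ q.eval (n + B.size) := fun i hi => by
      have h₁ := size_add_le B (i * G)
      have h₂ : i * G ≤ (n + B.size) * g.eval (n + B.size) :=
        Nat.mul_le_mul (by lia) (polynomial_eval_mono g (by lia))
      simp only [q, Polynomial.eval_add, Polynomial.eval_mul, Polynomial.eval_X]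
      lia
    have hW : W = C * (q.eval (n + B.size) + 1) + p.eval (q.eval (n + B.size)) := by
      simp [W, w]
    -- Induction on the number `j` of remaining iterations, since the run of a `while` loop is
    -- assembled from its first iteration and the run of the rest.
    have main : ∀ j i, i + j = n → ∀ m₁, Rep l m₁ (iter i (fun k τ => c.exec l (τ.set x 0 0 k)) σ) →
        (∀ a, m₁ a ≤ B + i * G) → m₁ (counterAddr n d) = i →
        ∃ m' t, Run (.while (.bin .sub lenExpr (.load (counterExpr d)))
          (.seq (.store (addrExpr x (.const 0) (.const 0)) (.load (counterExpr d)))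
          (.seq (c.compile (d + 1))
            (.store (counterExpr d) (.bin .add (.load (counterExpr d)) (.const 1)))))) m₁ m' t ∧
          Rep l m' (iter n (fun k τ => c.exec l (τ.set x 0 0 k)) σ) ∧
          (∀ a, m' a ≤ B + n * G) ∧
          (∀ k < d, m' (counterAddr n k) = m₁ (counterAddr n k)) ∧ t ≤ (j + 1) * W := by
      intro j
      induction j with
      | zero =>
        intro i hi m₁ h₁ hB₁ hc₁
        obtain rfl : n = i := by lia
        obtain ⟨s₁, s₂⟩ := hC₃ m₁ _ fun a => Nat.size_le_size (hB₁ a)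
        have hz := hsz n le_rfl
        refine ⟨m₁, _, Run.while_false ?_, h₁, hB₁, fun _ _ => rfl, ?_⟩
        · simp only [Expr.eval, counterExpr_eval h₁.len, Op.eval, lenExpr, h₁.len, ← hn, hc₁]
          lia
        · rw [hW]
          have : (2 * C₃ + 1) * ((B + n * G).size + 1) ≤ C * (q.eval (n + B.size) + 1) :=
            Nat.mul_le_mul (by lia) (by lia)
          lia
      | succ j ihj =>
        intro i hi m₁ h₁ hB₁ hc₁
        have hin : i < n := by lia
        obtain ⟨s₁, s₂⟩ := hC₃ m₁ _ fun a => Nat.size_le_size (hB₁ a)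
        obtain ⟨t₂, ht₂, r₂⟩ := hC₁ m₁ _ hB₁
        have e₂ : (Expr.load (counterExpr d)).eval m₁ = i := by
          simp only [Expr.eval, counterExpr_eval h₁.len, ← hn, hc₁]
        rw [addrExpr_eval h₁.len, e₂] at r₂
        simp only [Expr.eval] at r₂
        obtain ⟨m₃, t₃, r₃, h₃, hB₃, hk₃, ht₃⟩ := H l _ _ _ (h₁.update_cell x 0 0 i)
          (update_le hB₁ (by nlinarith))
        -- The body is compiled at depth `d + 1`, so it also preserves the counter of this very
        -- loop.
        have hk₃' : ∀ k ≤ d, m₃ (counterAddr n k) = m₁ (counterAddr n k) := fun k hk => by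
          rw [hk₃ k (by lia), Function.update_of_ne (by unfold counterAddr cellAddr; lia)]
        have hB₃' : ∀ a, m₃ a ≤ B + (i + 1) * G := fun a => by
          have := hB₃ a
          simp only [G, ← hn] at this ⊢
          lia
        obtain ⟨t₄, ht₄, r₄⟩ := hC₂ m₃ _ hB₃'
        have e₄ : (Expr.bin .add (.load (counterExpr d)) (.const 1)).eval m₃ = i + 1 := by
          simp only [Expr.eval, counterExpr_eval h₃.len, ← hn, hk₃' d le_rfl, hc₁, Op.eval]
        rw [counterExpr_eval h₃.len, e₄] at r₄
        obtain ⟨m₅, t₅, r₅, h₅, hB₅, hk₅, ht₅⟩ := ihj (i + 1) (by lia) _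
          (h₃.update_counter d (i + 1)) (update_le hB₃' (by nlinarith))
          (by rw [← hn, Function.update_self])
        refine ⟨m₅, _, Run.while_true ?_ (r₂.seq (r₃.seq r₄)) r₅, h₅, hB₅, fun k hk => ?_, ?_⟩
        · simp only [Expr.eval, counterExpr_eval h₁.len, Op.eval, lenExpr, h₁.len, ← hn, hc₁]
          lia
        · rw [hk₅ k hk, Function.update_of_ne (by unfold counterAddr; lia), hk₃' k hk.le]
        · have z₁ := hsz i hin.le
          have z₂ := hsz (i + 1) hin
          set Q := q.eval (n + B.size)
          have : t₃ ≤ p.eval Q := ht₃.trans (polynomial_eval_mono _ z₁)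
          have : (2 * C₃ + 1) * ((B + i * G).size + 1) ≤ (2 * C₃ + 1) * (Q + 1) :=
            Nat.mul_le_mul le_rfl (by lia)
          have : C₁ * ((B + i * G).size + 1) ≤ C₁ * (Q + 1) :=
            Nat.mul_le_mul le_rfl (by lia)
          have : C₂ * ((B + (i + 1) * G).size + 1) ≤ C₂ * (Q + 1) :=
            Nat.mul_le_mul le_rfl (by lia)
          have : W = C₀ * (Q + 1) + C₁ * (Q + 1) + C₂ * (Q + 1) + (2 * C₃ + 1) * (Q + 1) +
            p.eval Q := by rw [hW]; simp only [C]; ring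
          have : (j + 1 + 1) * W = (j + 1) * W + W := by ring
          lia
    obtain ⟨m', t, r, h', hB', hk', ht⟩ := main n 0 (by lia) _ (h.update_counter d 0)
      (by simpa using update_le hB (Nat.zero_le _)) (by rw [← hn, Function.update_self])
    refine ⟨m', _, r₀.seq r, h', fun a => ?_, fun k hk => ?_, ?_⟩
    · simpa using hB' a
    · rw [hk' k hk, Function.update_of_ne (by unfold counterAddr; lia)]
    · have z₀ := hsz 0 (Nat.zero_le _)
      have : C₀ * (B.size + 1) ≤ C * (q.eval (n + B.size) + 1) :=
        Nat.mul_le_mul (by lia) (by simp only [zero_mul, add_zero] at z₀; lia)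
      have e : ((Polynomial.X + 2) * w).eval (n + B.size) = (n + B.size + 2) * W := by
        simp [W]
      have : (n + 1) * W + W ≤ (n + B.size + 2) * W := by
        rw [← Nat.succ_mul]; exact Nat.mul_le_mul_right _ (by lia)
      rw [e]
      lia

/-! ### Delivery of the output -/

/-- Copies the array `out` to the cells `1, 2, …` and its length to cell `0`. -/
def outputProg (out outLen : ℕ) : Prog :=
  .seq (.store (counterExpr 0) (.const 0))
    (.seq (.while (.bin .sub lenExpr (.load (counterExpr 0)))
      (.seq (.store (.bin .add (.load (counterExpr 0)) (.const 1))
          (.load (addrExpr out (.load (counterExpr 0)) (.const 0))))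
        (.store (counterExpr 0) (.bin .add (.load (counterExpr 0)) (.const 1)))))
      (.store (.const 0) (.load (addrExpr outLen (.const 0) (.const 0)))))

/-- The copy overwrites the input in place, so only cell `0` and the store are kept invariant, not
`Rep`. Cell `0` is replaced last, because every address is computed from it. -/
theorem exists_run_outputProg (out outLen : ℕ) : ∃ p : Polynomial ℕ,
    ∀ l m σ B, Rep l m σ → (∀ a, m a ≤ B) → ∃ m' t, Run (outputProg out outLen) m m' t ∧
      m' 0 = σ outLen 0 0 ∧ (∀ i < l.length, m' (i + 1) = σ out i 0) ∧
      t ≤ p.eval (l.length + B.size) := by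
  obtain ⟨C₀, hC₀⟩ := exists_run_store (counterExpr 0) (.const 0)
  obtain ⟨C₁, hC₁⟩ := exists_run_store (.bin .add (.load (counterExpr 0)) (.const 1))
    (.load (addrExpr out (.load (counterExpr 0)) (.const 0)))
  obtain ⟨C₂, hC₂⟩ := exists_run_store (counterExpr 0)
    (.bin .add (.load (counterExpr 0)) (.const 1))
  obtain ⟨C₃, hC₃⟩ := (Expr.bin .sub lenExpr (.load (counterExpr 0))).exists_size_le
  obtain ⟨C₄, hC₄⟩ := exists_run_store (.const 0) (.load (addrExpr outLen (.const 0) (.const 0)))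
  let C := C₀ + C₁ + C₂ + 2 * C₃ + 1 + C₄
  refine ⟨(C : Polynomial ℕ) * (Polynomial.X + 1) * (Polynomial.X + 2), fun l m σ B h hB => ?_⟩
  obtain ⟨t₀, ht₀, r₀⟩ := hC₀ m B hB
  rw [counterExpr_eval h.len] at r₀
  set n := l.length with hn
  have hlen : n ≤ B := by rw [hn, ← h.len]; exact hB 0
  let W := (C₁ + C₂ + 2 * C₃ + 1) * (B.size + 1)
  have main : ∀ j i, i + j = n → ∀ m₁ : Mem, m₁ 0 = n →
      (∀ t i j, m₁ (cellAddr n t i j) = σ t i j) → (∀ k < i, m₁ (k + 1) = σ out k 0) →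
      (∀ a, m₁ a ≤ B) → m₁ (counterAddr n 0) = i →
      ∃ m' t, Run (.while (.bin .sub lenExpr (.load (counterExpr 0)))
      (.seq (.store (.bin .add (.load (counterExpr 0)) (.const 1))
          (.load (addrExpr out (.load (counterExpr 0)) (.const 0))))
        (.store (counterExpr 0) (.bin .add (.load (counterExpr 0)) (.const 1))))) m₁ m' t ∧
        m' 0 = n ∧ (∀ t i j, m' (cellAddr n t i j) = σ t i j) ∧
        (∀ k < n, m' (k + 1) = σ out k 0) ∧ (∀ a, m' a ≤ B) ∧ t ≤ (j + 1) * W := by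
    intro j
    induction j with
    | zero =>
      intro i hi m₁ h₀ h₁ h₂ hB₁ hc₁
      obtain rfl : n = i := by lia
      obtain ⟨s₁, s₂⟩ := hC₃ m₁ _ fun a => Nat.size_le_size (hB₁ a)
      refine ⟨m₁, _, Run.while_false ?_, h₀, h₁, h₂, hB₁, ?_⟩
      · simp only [Expr.eval, counterExpr_eval h₀, Op.eval, lenExpr, h₀, hc₁]
        lia
      · simp only [W]
        nlinarith
    | succ j ihj =>
      intro i hi m₁ h₀ h₁ h₂ hB₁ hc₁
      have hin : i < n := by lia
      obtain ⟨s₁, s₂⟩ := hC₃ m₁ _ fun a => Nat.size_le_size (hB₁ a)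
      obtain ⟨t₂, ht₂, r₂⟩ := hC₁ m₁ _ hB₁
      simp only [Expr.eval, addrExpr_eval h₀, counterExpr_eval h₀, hc₁, Op.eval, h₁] at r₂
      set m₂ := Function.update m₁ (i + 1) (σ out i 0) with hm₂
      have hB₂ : ∀ a, m₂ a ≤ B := update_le hB₁ (by rw [← h₁]; exact hB₁ _)
      have h₀₂ : m₂ 0 = n := by rw [hm₂, Function.update_of_ne (by lia), h₀]
      have hc₂ : m₂ (counterAddr n 0) = i := by
        rw [hm₂, Function.update_of_ne (by unfold counterAddr; lia), hc₁]
      obtain ⟨t₃, ht₃, r₃⟩ := hC₂ m₂ _ hB₂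
      simp only [Expr.eval, counterExpr_eval h₀₂, hc₂, Op.eval] at r₃
      obtain ⟨m₄, t₄, r₄, a₄, b₄, c₄, d₄, e₄⟩ := ihj (i + 1) (by lia)
        (Function.update m₂ (counterAddr n 0) (i + 1))
        (by rw [Function.update_of_ne (by unfold counterAddr; lia), h₀₂])
        (fun t i' j' => by
          rw [Function.update_of_ne (by unfold counterAddr cellAddr; lia), hm₂,
            Function.update_of_ne (by unfold cellAddr; lia), h₁])
        (fun k hk => by
          rw [Function.update_of_ne (by unfold counterAddr; lia), hm₂]
          rcases Nat.lt_succ_iff_lt_or_eq.1 hk with hk | rfl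
          · rw [Function.update_of_ne (by lia), h₂ k hk]
          · rw [Function.update_self])
        (update_le hB₂ (by lia)) (Function.update_self ..)
      refine ⟨m₄, _, Run.while_true ?_ (r₂.seq r₃) r₄, a₄, b₄, c₄, d₄, ?_⟩
      · simp only [Expr.eval, counterExpr_eval h₀, Op.eval, lenExpr, h₀, hc₁]
        lia
      · have : (j + 1 + 1) * W = (j + 1) * W + W := by ring
        have : W = C₁ * (B.size + 1) + C₂ * (B.size + 1) + 2 * (C₃ * (B.size + 1)) +
          (B.size + 1) := by simp only [W]; ring
        lia
  obtain ⟨m₁, t₁, r₁, a₁, b₁, c₁, d₁, e₁⟩ := main n 0 (by lia)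
    (Function.update m (counterAddr n 0) 0)
    (h.update_counter 0 0).len (h.update_counter 0 0).cell (by lia)
    (update_le hB (Nat.zero_le _)) (Function.update_self ..)
  obtain ⟨t₂, ht₂, r₂⟩ := hC₄ m₁ B d₁
  simp only [Expr.eval, addrExpr_eval a₁, b₁] at r₂
  refine ⟨_, _, r₀.seq (r₁.seq r₂), Function.update_self .., fun i hi => ?_, ?_⟩
  · rw [Function.update_of_ne (by lia), c₁ i hi]
  · have e : ((C : Polynomial ℕ) * (Polynomial.X + 1) * (Polynomial.X + 2)).eval (n + B.size) =
        (C₀ + C₄) * (n + B.size + 1) * (n + B.size + 2) +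
        (C₁ + C₂ + 2 * C₃ + 1) * (n + B.size + 1) * (n + B.size + 2) := by
      simp [C]; ring
    have i₁ : (C₀ + C₄) * (B.size + 1) * 1 ≤ (C₀ + C₄) * (n + B.size + 1) * (n + B.size + 2) := by
      gcongr <;> lia
    have i₂ : (C₁ + C₂ + 2 * C₃ + 1) * (B.size + 1) * (n + 1) ≤
        (C₁ + C₂ + 2 * C₃ + 1) * (n + B.size + 1) * (n + B.size + 2) := by
      gcongr <;> lia
    simp only [W] at e₁
    rw [e]
    lia

/-! ### From correct commands to polynomial-time solvability -/

theorem rep_inputMem (l : List ℕ) : Rep l (inputMem l) fun _ _ _ => 0 where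
  len := rfl
  inp _ _ := rfl
  cell t i j := by
    show inputMem l (cellAddr _ _ _ _) = 0
    rw [show cellAddr l.length t i j = l.length + 2 * sqPair t (sqPair i j) + 1 by
      unfold cellAddr; lia]
    exact List.getD_eq_default _ _ (by lia)

theorem length_le_bitLength (l : List ℕ) : l.length ≤ bitLength l := by
  induction l with
  | nil => simp
  | cons a l ih => simp only [bitLength, List.map_cons, List.sum_cons, List.length_cons] at *; lia

theorem size_le_bitLength {l : List ℕ} {a : ℕ} (h : a ∈ l) : a.size ≤ bitLength l := by
  have : a.size + 1 ∈ l.map fun n => n.size + 1 := List.mem_map_of_mem h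
  have := List.le_sum_of_mem this
  unfold bitLength; lia

theorem inputMem_le (l : List ℕ) (a : ℕ) : inputMem l a ≤ 2 ^ bitLength l := by
  cases a with
  | zero => exact (length_le_bitLength l).trans Nat.lt_two_pow_self.le
  | succ i =>
    simp only [inputMem]
    by_cases h : i < l.length
    · rw [List.getD_eq_getElem _ _ h]
      exact (Nat.size_le.1 (size_le_bitLength (List.getElem_mem h))).le
    · rw [List.getD_eq_default _ _ (by lia)]; exact Nat.zero_le _

/-- A search problem solved by a tame command of the loop language is solvable in polynomial
time. -/
theorem polyTimeSolvable_of_cmd {X : Type} {Y : X → Type} {encodeIn : X → List ℕ}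
    {encodeOut : (x : X) → Y x → List ℕ} {IsAnswer : (x : X) → Y x → Prop} (c : Cmd)
    (hc : c.tame) (out outLen : ℕ)
    (H : ∀ x, ∃ y, IsAnswer x y ∧ (encodeOut x y).length ≤ (encodeIn x).length ∧
      c.exec (encodeIn x) (fun _ _ _ => 0) outLen 0 0 = (encodeOut x y).length ∧
      ∀ i (h : i < (encodeOut x y).length),
        c.exec (encodeIn x) (fun _ _ _ => 0) out i 0 = (encodeOut x y)[i]) :
    PolyTimeSolvable encodeIn encodeOut IsAnswer := by
  obtain ⟨g, p, hp⟩ := c.exists_run hc 0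
  obtain ⟨q, hq⟩ := exists_run_outputProg out outLen
  -- Initially all cells are at most `2 ^ bitLength l`, a number of size `bitLength l + 1`; with the
  -- length of the word this gives `2 * X + 1`. The summand `g` accounts for the growth during the
  -- run of `c`.
  refine ⟨.seq (c.compile 0) (outputProg out outLen),
    p.comp (2 * Polynomial.X + 1) + q.comp (2 * Polynomial.X + 1 + g), fun x => ?_⟩
  obtain ⟨y, hy, hle, hlen, hout⟩ := H x
  set l := encodeIn x
  obtain ⟨m₁, t₁, r₁, h₁, hB₁, -, ht₁⟩ := hp l _ _ _ (rep_inputMem l) (inputMem_le l)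
  obtain ⟨m₂, t₂, r₂, h₂, h₃, ht₂⟩ := hq l _ _ _ h₁ hB₁
  refine ⟨y, hy, m₂, _, r₁.seq r₂, ?_, h₂.trans hlen, fun i hi => ?_⟩
  · simp only [Polynomial.eval_add, Polynomial.eval_comp, Polynomial.eval_X,
      Polynomial.eval_mul, Polynomial.eval_one, Polynomial.eval_ofNat]
    have hl := length_le_bitLength l
    have hg := polynomial_eval_mono g hl
    have hs : (2 ^ bitLength l).size = bitLength l + 1 := Nat.size_pow
    have hs' := size_add_le (2 ^ bitLength l) (g.eval l.length)
    exact Nat.add_le_add (ht₁.trans (polynomial_eval_mono _ (by lia)))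
      (ht₂.trans (polynomial_eval_mono _ (by lia)))
  · rw [h₃ i (hi.trans_le hle), hout]

end RAM

/-! # Integral flows, cuts and the greedy selection of sources -/

namespace FlowNet

open Finset

set_option linter.unusedSectionVars false

variable {α ι : Type} [Fintype α] [DecidableEq α] [DecidableEq ι]

/-- The net amount of flow leaving a node. -/
def net (f : α → α → ℕ) (v : α) : ℤ := ∑ w, (f v w : ℤ) - ∑ w, (f w v : ℤ)

/-- Serves both `push`, with either sign of `δ`, and `pull`. -/
theorem net_of_change {f f' : α → α → ℕ} {a b : α} {δ : ℤ}
    (h : ∀ x y, (f' x y : ℤ) = f x y + if x = a ∧ y = b then δ else 0) (v : α) :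
    net f' v = net f v + (if v = a then δ else 0) - if v = b then δ else 0 := by
  have h₁ : ∑ w, (f' v w : ℤ) = ∑ w, (f v w : ℤ) + if v = a then δ else 0 := by
    simp only [h, sum_add_distrib]
    by_cases hv : v = a <;> simp [hv]
  have h₂ : ∑ w, (f' w v : ℤ) = ∑ w, (f w v : ℤ) + if v = b then δ else 0 := by
    simp only [h, sum_add_distrib]
    by_cases hv : v = b <;> simp [hv]
  simp only [net, h₁, h₂]; ring

/-- Arcs inside `X` are counted once with each sign and cancel. -/
theorem sum_net (f : α → α → ℕ) (X : Finset α) :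
    ∑ v ∈ X, net f v = ∑ v ∈ X, ∑ w ∈ Xᶜ, (f v w : ℤ) - ∑ v ∈ X, ∑ w ∈ Xᶜ, (f w v : ℤ) := by
  simp only [net, sum_sub_distrib]
  have e₁ : ∀ g : α → ℤ, ∑ w, g w = ∑ w ∈ X, g w + ∑ w ∈ Xᶜ, g w := fun g =>
    (sum_add_sum_compl X g).symm
  simp only [e₁, sum_add_distrib]
  rw [sum_comm (s := X) (t := X) (f := fun v w => (f w v : ℤ))]
  ring

/-- The number of sources at a node. -/
def demand (src : ι → α) (S : Finset ι) (v : α) : ℕ := #{c ∈ S | src c = v}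

theorem sum_demand (src : ι → α) (S : Finset ι) (X : Finset α) :
    ∑ v ∈ X, demand src S v = #{c ∈ S | src c ∈ X} := by
  rw [card_eq_sum_card_fiberwise (f := src) (t := X) (by intro c hc; simpa using (mem_filter.1 hc).2)]
  refine sum_congr rfl fun v hv => ?_
  unfold demand
  congr 1
  ext c
  simp only [mem_filter]
  constructor
  · rintro ⟨h₁, rfl⟩; exact ⟨⟨h₁, hv⟩, rfl⟩
  · rintro ⟨⟨h₁, _⟩, h₂⟩; exact ⟨h₁, h₂⟩

theorem demand_insert (src : ι → α) {S : Finset ι} {c : ι} (hc : c ∉ S) (v : α) :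
    demand src (insert c S) v = demand src S v + if v = src c then 1 else 0 := by
  unfold demand
  rw [filter_insert]
  by_cases h : src c = v
  · rw [if_pos h, if_pos h.symm, card_insert_of_notMem (by simp [hc])]
  · rw [if_neg h, if_neg (Ne.symm h), add_zero]

/-- `f` sends one unit from every source in `S` to `t`. -/
def IsFlow (t : α) (src : ι → α) (S : Finset ι) (f : α → α → ℕ) : Prop :=
  ∀ v ≠ t, net f v = demand src S v

theorem IsFlow.sum_cut {t : α} {src : ι → α} {S : Finset ι} {f : α → α → ℕ}
    (h : IsFlow t src S f) {X : Finset α} (ht : t ∉ X) :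
    (∑ v ∈ X, ∑ w ∈ Xᶜ, (f v w : ℤ)) - ∑ v ∈ X, ∑ w ∈ Xᶜ, (f w v : ℤ) = #{c ∈ S | src c ∈ X} := by
  rw [← sum_net, ← sum_demand]
  push_cast
  exact sum_congr rfl fun v hv => h v (by rintro rfl; exact ht hv)

/-- No residual arc leaves `X`. -/
def Closed (cap f : α → α → ℕ) (X : Finset α) : Prop :=
  ∀ v ∈ X, ∀ w ∉ X, cap v w ≤ f v w ∧ f w v = 0

/-- No cut obstructs the simultaneous routing of the sources in `O` to `t`. -/
def CutCond (cap : α → α → ℕ) (t : α) (src : ι → α) (O : Finset ι) : Prop :=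
  ∀ X : Finset α, t ∉ X → #{c ∈ O | src c ∈ X} ≤ ∑ v ∈ X, ∑ w ∈ Xᶜ, cap v w

/-- Nothing flows into `X` and all arcs leaving it are saturated, so the sources of `S` in `X` are
at least as many as the capacity of the cut, which bounds those of `O`. Outside `X` every source in
`D` already belongs to `S`. -/
theorem card_le_of_closed {cap f : α → α → ℕ} {t : α} {src : ι → α} {D S O : Finset ι}
    (hf : IsFlow t src S f) {X : Finset α} (ht : t ∉ X) (hX : Closed cap f X)
    (hD : ∀ c ∈ D, c ∉ S → src c ∈ X) (hO : CutCond cap t src O) :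
    #(O ∩ D) ≤ #S := by
  have h₁ : #{c ∈ O | src c ∈ X} ≤ #{c ∈ S | src c ∈ X} := by
    refine (hO X ht).trans ?_
    have h := hf.sum_cut ht
    have h₂ : ∑ v ∈ X, ∑ w ∈ Xᶜ, (f w v : ℤ) = 0 :=
      sum_eq_zero fun v hv => sum_eq_zero fun w hw => by
        rw [(hX v hv w (mem_compl.1 hw)).2]; rfl
    rw [h₂, sub_zero] at h
    zify
    rw [← h]
    refine sum_le_sum fun v hv => sum_le_sum fun w hw => ?_
    exact_mod_cast (hX v hv w (mem_compl.1 hw)).1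
  have h₂ : #{c ∈ O ∩ D | src c ∈ X} ≤ #{c ∈ O | src c ∈ X} :=
    card_le_card (filter_subset_filter _ inter_subset_left)
  have h₃ : #{c ∈ O ∩ D | ¬ src c ∈ X} ≤ #{c ∈ S | ¬ src c ∈ X} := by
    refine card_le_card fun c hc => ?_
    simp only [mem_filter, mem_inter] at hc ⊢
    exact ⟨by_contra fun h => hc.2 (hD c hc.1.2 h), hc.2⟩
  have := card_filter_add_card_filter_not (s := O ∩ D) (fun c => src c ∈ X)
  have := card_filter_add_card_filter_not (s := S) (fun c => src c ∈ X)
  lia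

/-! ### Optimality of the greedy selection -/

/-- The state of the greedy selection after the sources in `D` have been considered in the order
of decreasing utility, and those in `S` have been accepted. -/
structure Greedy (cap : α → α → ℕ) (t : α) (src : ι → α) (u : ι → ℚ) (D S : Finset ι)
    (f : α → α → ℕ) : Prop where
  subset : S ⊆ D
  le : ∀ v w, f v w ≤ cap v w
  flow : IsFlow t src S f
  cut : ∃ X, t ∉ X ∧ Closed cap f X ∧ ∀ c ∈ D, c ∉ S → src c ∈ X
  opt : ∀ O, CutCond cap t src O → ∀ τ : ℚ, 0 ≤ τ → (∀ c ∈ D, τ ≤ u c) →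
    τ * ((#S : ℚ) - #(O ∩ D)) ≤ ∑ c ∈ S, u c - ∑ c ∈ O ∩ D, u c

theorem Greedy.init (cap : α → α → ℕ) (t : α) (src : ι → α) (u : ι → ℚ) :
    Greedy cap t src u ∅ ∅ fun _ _ => 0 where
  subset := subset_rfl
  le _ _ := Nat.zero_le _
  flow v _ := by simp [net, demand]
  cut := ⟨∅, by simp, fun v hv => by simp at hv, by simp⟩
  opt := by simp

/-- Summation by parts, one term at a time: in `opt`, `τ` is any lower threshold for the utilities
considered. The old inequality at `τ = u c` survives adding `c` to either side, and then `u c` may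
be lowered to `τ` because the difference of cardinalities is nonnegative. -/
theorem Greedy.step {cap : α → α → ℕ} {t : α} {src : ι → α} {u : ι → ℚ} {D S S' : Finset ι}
    {f f' : α → α → ℕ} {c : ι} (h : Greedy cap t src u D S f) (hc : c ∉ D) (h₀ : 0 ≤ u c)
    (hu : ∀ d ∈ D, u c ≤ u d) (hS' : S' = S ∨ S' = insert c S) (hle : ∀ v w, f' v w ≤ cap v w)
    (hflow : IsFlow t src S' f')
    (hcut : ∃ X, t ∉ X ∧ Closed cap f' X ∧ ∀ d ∈ insert c D, d ∉ S' → src d ∈ X) :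
    Greedy cap t src u (insert c D) S' f' where
  subset := by
    rcases hS' with rfl | rfl
    · exact h.subset.trans (subset_insert _ _)
    · exact insert_subset_insert _ h.subset
  le := hle
  flow := hflow
  cut := hcut
  opt O hO τ hτ hD := by
    obtain ⟨X, hX₁, hX₂, hX₃⟩ := hcut
    have hcard := card_le_of_closed hflow hX₁ hX₂ hX₃ hO
    -- Considering clients in decreasing order makes `u c` an admissible threshold for `D`.
    have hold := h.opt O hO (u c) h₀ hu
    have hτc := hD c (mem_insert_self _ _)
    have hcS : c ∉ S := fun h' => hc (h.subset h')
    have hcO : c ∉ O ∩ D := fun h' => hc (mem_inter.1 h').2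
    have key : u c * ((#S' : ℚ) - #(O ∩ insert c D)) ≤
        ∑ c ∈ S', u c - ∑ c ∈ O ∩ insert c D, u c := by
      have hO' : c ∉ O → O ∩ insert c D = O ∩ D := fun h => inter_insert_of_notMem h
      have hO'' : c ∈ O → O ∩ insert c D = insert c (O ∩ D) := fun h => inter_insert_of_mem h
      rcases hS' with rfl | rfl <;> by_cases hcO' : c ∈ O
      · rw [hO'' hcO', sum_insert hcO, card_insert_of_notMem hcO]; push_cast; linarith
      · rw [hO' hcO']; exact hold
      · rw [hO'' hcO', sum_insert hcO, card_insert_of_notMem hcO, sum_insert hcS,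
          card_insert_of_notMem hcS]; push_cast; linarith
      · rw [hO' hcO', sum_insert hcS, card_insert_of_notMem hcS]; push_cast; linarith
    refine le_trans (mul_le_mul_of_nonneg_right hτc ?_) key
    rw [sub_nonneg]
    exact_mod_cast hcard

/-- The threshold `τ = 0` compares `S` with `O ∩ D`; the rest of `O` contributes nothing positive.
-/
theorem Greedy.sum_le {cap : α → α → ℕ} {t : α} {src : ι → α} {u : ι → ℚ} {D S O : Finset ι}
    {f : α → α → ℕ} (h : Greedy cap t src u D S f) (hD₀ : ∀ c ∈ D, 0 ≤ u c)
    (hD : ∀ c, c ∉ D → u c ≤ 0) (hO : CutCond cap t src O) : ∑ c ∈ O, u c ≤ ∑ c ∈ S, u c := by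
  have h₁ := h.opt O hO 0 le_rfl hD₀
  have h₂ : ∑ c ∈ O \ D, u c ≤ 0 := sum_nonpos fun c hc => hD c (mem_sdiff.1 hc).2
  have h₃ := sum_inter_add_sum_sdiff O D u
  linarith

/-! ## Search trees -/

/-- A tree of shortest or other paths along `A` to `t`, spanning all nodes from which `t` can be
reached: `nxt v` is the node after `v`, and `dst v` the distance to `t` in the tree. -/
structure IsTree (A : α → α → Prop) (t : α) (vis : α → Prop) (nxt : α → α) (dst : α → ℕ) :
    Prop where
  root : vis t
  dst_root : dst t = 0
  next : ∀ v, vis v → v ≠ t → vis (nxt v) ∧ A v (nxt v) ∧ dst v = dst (nxt v) + 1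
  closed : ∀ v w, vis w → A v w → vis v

/-- The arcs of the residual network. -/
def Residual (cap f : α → α → ℕ) (v w : α) : Prop := f v w < cap v w ∨ 0 < f w v

section Tree

variable {cap f₀ f : α → α → ℕ} {t : α} {vis : α → Prop} {nxt : α → α} {dst : α → ℕ}

/-- A tree path starting in `X` would have to leave it along a residual arc. Hence the unvisited
nodes include the old `X`, so rejected sources remain cut off from the sink. -/
theorem IsTree.notMem_of_closed (h : IsTree (Residual cap f₀) t vis nxt dst) {X : Finset α}
    (ht : t ∉ X) (hX : Closed cap f₀ X) (v : α) (hv : vis v) : v ∉ X := by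
  induction hd : dst v generalizing v with
  | zero =>
    by_cases hvt : v = t
    · rwa [hvt]
    · have := (h.next v hv hvt).2.2; lia
  | succ d ih =>
    by_cases hvt : v = t
    · rwa [hvt]
    · obtain ⟨h₁, h₂, h₃⟩ := h.next v hv hvt
      intro hvX
      have h₄ := hX v hvX _ (ih _ h₁ (by lia))
      unfold Residual at h₂
      lia

open Classical in
theorem IsTree.closed_compl (h : IsTree (Residual cap f₀) t vis nxt dst) :
    Closed cap f₀ ({v | ¬ vis v} : Finset α) := by
  intro v hv w hw
  simp only [mem_filter, mem_univ, true_and, not_not] at hv hw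
  have := mt (h.closed v w hw) hv
  unfold Residual at this
  lia

/-- The tree path of `v` meets every smaller distance. This bounds the number of rounds needed to
walk down to the sink. -/
theorem IsTree.dst_lt_card {A : α → α → Prop} (h : IsTree A t vis nxt dst) {v : α} (hv : vis v) :
    dst v < Fintype.card α := by
  have key : ∀ d v, vis v → dst v = d → d ≤ #{w | dst w < d} := by
    intro d
    induction d with
    | zero => intro v _ _; exact Nat.zero_le _
    | succ d ih =>
      intro v hv hd
      obtain ⟨h₁, -, h₃⟩ := h.next v hv (by rintro rfl; rw [h.dst_root] at hd; lia)
      have hy : dst (nxt v) = d := by lia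
      have h₄ := ih _ h₁ hy
      have hss : ({w | dst w < d} : Finset α) ⊂ ({w | dst w < d + 1} : Finset α) := by
        refine (ssubset_iff_of_subset fun w hw => ?_).2 ⟨nxt v, ?_, ?_⟩
        · simp only [mem_filter, mem_univ, true_and] at hw ⊢; lia
        · simp [hy]
        · simp [hy]
      have := card_lt_card hss
      lia
  refine (key _ v hv rfl).trans_lt (card_lt_univ_of_notMem (x := v) (by simp))

/-! ### Augmentation along a tree path -/

/-- Sends one unit along the residual arc from `x` to `y`. -/
def push (f : α → α → ℕ) (x y : α) : α → α → ℕ := fun v w =>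
  if f y x ≠ 0 then (if v = y ∧ w = x then f y x - 1 else f v w)
  else (if v = x ∧ w = y then f x y + 1 else f v w)

theorem net_push (f : α → α → ℕ) (x y v : α) :
    net (push f x y) v = net f v + (if v = x then 1 else 0) - if v = y then 1 else 0 := by
  by_cases h : f y x ≠ 0
  · rw [net_of_change (f := f) (a := y) (b := x) (δ := -1)]
    · split_ifs <;> lia
    · intro p q
      simp only [push, if_pos h]
      by_cases hp : p = y ∧ q = x
      · simp only [hp, and_self, if_true]; lia
      · simp only [hp, if_false, add_zero]
  · rw [net_of_change (f := f) (a := x) (b := y) (δ := 1)]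
    intro p q
    simp only [push, if_neg h]
    by_cases hp : p = x ∧ q = y
    · simp only [hp, and_self, if_true]; lia
    · simp only [hp, if_false]; simp

theorem push_of_not {x y v w : α} (h₁ : ¬ (v = x ∧ w = y)) (h₂ : ¬ (v = y ∧ w = x)) :
    push f x y v w = f v w := by
  simp [push, h₁, h₂]

/-- `f` arises from `f₀` by sending one unit along the tree from `a` to `x`. -/
structure Augment (cap f₀ : α → α → ℕ) (vis : α → Prop) (dst : α → ℕ) (a x : α)
    (f : α → α → ℕ) : Prop where
  reached : vis x
  le : ∀ v w, f v w ≤ cap v w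
  net : ∀ v, net f v = net f₀ v + (if v = a then 1 else 0) - if v = x then 1 else 0
  low : ∀ v w, dst v ≤ dst x → dst w ≤ dst x → f v w = f₀ v w
  unvis : ∀ v w, ¬ (vis v ∧ vis w) → f v w = f₀ v w

theorem Augment.init {a : α} (hv : vis a) (hle : ∀ v w, f₀ v w ≤ cap v w) :
    Augment cap f₀ vis dst a a f₀ :=
  ⟨hv, hle, by simp, fun _ _ _ _ => rfl, fun _ _ _ => rfl⟩

/-- Both ends of the next arc have distance at most `dst x`, where by `low` the flow is still `f₀`;
so an arc residual for `f₀` is residual now. Only arcs at `x` change, and `x` is farther from the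
sink than `nxt x`, which preserves `low`. -/
theorem Augment.step {a x : α} (ht : IsTree (Residual cap f₀) t vis nxt dst)
    (h : Augment cap f₀ vis dst a x f) (hx : x ≠ t) :
    Augment cap f₀ vis dst a (nxt x) (push f x (nxt x)) := by
  obtain ⟨h₁, h₂, h₃⟩ := ht.next x h.reached hx
  refine ⟨h₁, fun v w => ?_, fun v => ?_, fun v w hv hw => ?_, fun v w hvw => ?_⟩
  · have l₁ := h.le v w
    unfold Residual at h₂
    rw [← h.low _ _ le_rfl (by lia), ← h.low _ _ (by lia) le_rfl] at h₂
    unfold push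
    split_ifs with p q q
    · rw [q.1, q.2] at l₁; lia
    · exact l₁
    · rw [q.1, q.2]; lia
    · exact l₁
  · rw [net_push, h.net]; ring
  · rw [push_of_not (by rintro ⟨rfl, rfl⟩; lia) (by rintro ⟨rfl, rfl⟩; lia),
      h.low v w (by lia) (by lia)]
  · rw [push_of_not, h.unvis v w hvw]
    · rintro ⟨rfl, rfl⟩; exact hvw ⟨h.reached, h₁⟩
    · rintro ⟨rfl, rfl⟩; exact hvw ⟨h₁, h.reached⟩

/-- The new certificate is the set of unvisited nodes: it contains the source of `c` as well as the
old certificate. -/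
theorem Greedy.reject {src : ι → α} {u : ι → ℚ} {D S : Finset ι} {c : ι}
    (h : Greedy cap t src u D S f₀) (hc : c ∉ D) (h₀ : 0 ≤ u c) (hu : ∀ d ∈ D, u c ≤ u d)
    (ht : IsTree (Residual cap f₀) t vis nxt dst) (hv : ¬ vis (src c)) :
    Greedy cap t src u (insert c D) S f₀ := by
  classical
  obtain ⟨X, hX₁, hX₂, hX₃⟩ := h.cut
  refine h.step hc h₀ hu (Or.inl rfl) h.le h.flow
    ⟨_, by simpa using ht.root, ht.closed_compl, fun d hd hdS => ?_⟩
  simp only [mem_filter, mem_univ, true_and]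
  rcases mem_insert.1 hd with rfl | hd
  · exact hv
  · exact fun hvd => ht.notMem_of_closed hX₁ hX₂ _ hvd (hX₃ d hd hdS)

/-- The set of unvisited nodes is closed for `f₀`, and it stays closed for `f` because the
augmentation changes only arcs between visited nodes. -/
theorem Greedy.accept {src : ι → α} {u : ι → ℚ} {D S : Finset ι} {c : ι}
    (h : Greedy cap t src u D S f₀) (hc : c ∉ D) (h₀ : 0 ≤ u c) (hu : ∀ d ∈ D, u c ≤ u d)
    (ht : IsTree (Residual cap f₀) t vis nxt dst) (hf : Augment cap f₀ vis dst (src c) t f) :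
    Greedy cap t src u (insert c D) (insert c S) f := by
  classical
  obtain ⟨X, hX₁, hX₂, hX₃⟩ := h.cut
  have hcS : c ∉ S := fun h' => hc (h.subset h')
  refine h.step hc h₀ hu (Or.inr rfl) hf.le (fun v hv => ?_)
    ⟨({v | ¬ vis v} : Finset α), by simpa using ht.root, fun v hv w hw => ?_, fun d hd hdS => ?_⟩
  · rw [hf.net, h.flow v hv, demand_insert src hcS, if_neg hv]
    push_cast; ring
  · have h' := ht.closed_compl v hv w hw
    simp only [mem_filter, mem_univ, true_and, not_not] at hv hw
    rwa [hf.unvis v w (fun h => hv h.1), hf.unvis w v (fun h => hv h.2)]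
  · simp only [mem_insert, not_or] at hd hdS
    simp only [mem_filter, mem_univ, true_and]
    exact fun hvd => ht.notMem_of_closed hX₁ hX₂ _ hvd (hX₃ d (hd.resolve_left hdS.1) hdS.2)

/-! ## Extraction of paths -/

/-- Every source is joined to `t` by a path of arcs that carry flow. -/
theorem IsFlow.vis_of_mem {src : ι → α} {S : Finset ι} {c : ι} (h : IsFlow t src S f)
    (ht : IsTree (fun v w => 0 < f v w) t vis nxt dst) (hc : c ∈ S) : vis (src c) := by
  classical
  -- No flow leaves the set of unvisited nodes, so its net outflow is at most zero, although it
  -- contains the source of `c`.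
  by_contra hv
  have h₁ := h.sum_cut (X := ({v | ¬ vis v} : Finset α)) (by simpa using ht.root)
  have h₂ : ∑ v ∈ ({v | ¬ vis v} : Finset α), ∑ w ∈ ({v | ¬ vis v} : Finset α)ᶜ, (f v w : ℤ) = 0 :=
    sum_eq_zero fun v hv => sum_eq_zero fun w hw => by
      simp only [mem_compl, mem_filter, mem_univ, true_and, not_not] at hv hw
      have := mt (ht.closed v w hw) hv
      simp only [Nat.pos_iff_ne_zero, not_not] at this
      rw [this]; rfl
  have h₃ : 0 ≤ ∑ v ∈ ({v | ¬ vis v} : Finset α), ∑ w ∈ ({v | ¬ vis v} : Finset α)ᶜ, (f w v : ℤ) :=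
    sum_nonneg fun v _ => sum_nonneg fun w _ => Int.natCast_nonneg _
  have h₄ : 0 < #{c ∈ S | src c ∈ ({v | ¬ vis v} : Finset α)} :=
    card_pos.2 ⟨c, by simpa using ⟨hc, hv⟩⟩
  lia

/-- Removes one unit from the arc from `x` to `y`. -/
def pull (f : α → α → ℕ) (x y : α) : α → α → ℕ := fun v w =>
  if v = x ∧ w = y then f x y - 1 else f v w

/-- `f` arises from `f₀` by removing one unit along the tree path `P` from `a` to `x`. -/
structure Peel (f₀ : α → α → ℕ) (vis : α → Prop) (dst : α → ℕ) (a x : α) (P : List α)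
    (f : α → α → ℕ) : Prop where
  reached : vis x
  net : ∀ v, net f v = net f₀ v - (if v = a then 1 else 0) + if v = x then 1 else 0
  low : ∀ v w, dst v ≤ dst x → dst w ≤ dst x → f v w = f₀ v w
  use : ∀ v w, f v w + (if [v, w] <:+: P then 1 else 0) = f₀ v w
  head : P.head? = some a
  last : P.getLast? = some x
  pairwise : P.Pairwise fun v w => dst w < dst v
  chain : P.IsChain fun v w => 0 < f₀ v w
  length : P.length + dst x = dst a + 1

theorem Peel.init {a : α} (hv : vis a) : Peel f₀ vis dst a a [a] f₀ where
  reached := hv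
  net v := by ring
  low _ _ _ _ := rfl
  use v w := by
    rw [if_neg, add_zero]
    intro h; have := h.length_le; simp at this
  head := rfl
  last := rfl
  pairwise := by simp
  chain := by simp
  length := by simp [add_comm]

/-- Distances strictly decrease along `P`, so `nxt x` is new, the arc to it is not yet on the path,
and its flow is still that of `f₀`. The list is therefore simple without any minimality of the tree.
-/
theorem Peel.step {a x : α} {P : List α}
    (ht : IsTree (fun v w => 0 < f₀ v w) t vis nxt dst)
    (h : Peel f₀ vis dst a x P f) (hx : x ≠ t) :
    Peel f₀ vis dst a (nxt x) (P ++ [nxt x]) (pull f x (nxt x)) := by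
  obtain ⟨h₁, h₂, h₃⟩ := ht.next x h.reached hx
  have hpos : 0 < f x (nxt x) := by rw [h.low _ _ le_rfl (by lia)]; exact h₂
  obtain ⟨Q, rfl⟩ : ∃ Q, P = Q ++ [x] := by
    have := h.last
    rw [List.getLast?_eq_some_iff] at this
    exact this
  have hd : ∀ v ∈ Q ++ [x], dst x ≤ dst v := by
    intro v hv
    rcases List.mem_append.1 hv with hv | hv
    · exact ((List.pairwise_append.1 h.pairwise).2.2 v hv x (by simp)).le
    · rw [List.mem_singleton.1 hv]
  have hnotin : nxt x ∉ Q ++ [x] := fun hm => by have := hd _ hm; lia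
  have hinf : ∀ v w, [v, w] <:+: Q ++ [x] ++ [nxt x] ↔ (v = x ∧ w = nxt x) ∨ [v, w] <:+: Q ++ [x] := by
    intro v w
    rw [List.infix_concat_iff]
    refine or_congr_left ?_
    constructor
    · rintro ⟨R, hR⟩
      have e : R ++ [v] ++ [w] = Q ++ [x] ++ [nxt x] := by simpa using hR
      obtain ⟨e₁, e₂⟩ := List.append_inj' e rfl
      obtain ⟨-, e₃⟩ := List.append_inj' e₁ rfl
      exact ⟨by simpa using e₃, by simpa using e₂⟩
    · rintro ⟨rfl, rfl⟩; exact ⟨Q, by simp⟩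
  have hex : ¬ [x, nxt x] <:+: Q ++ [x] := fun hi => hnotin (hi.subset (by simp))
  refine ⟨h₁, fun v => ?_, fun v w hv hw => ?_, fun v w => ?_, ?_, by simp, ?_, ?_, ?_⟩
  · rw [net_of_change (f := f) (a := x) (b := nxt x) (δ := -1), h.net]
    · split_ifs <;> ring
    · intro p q
      unfold pull
      by_cases hp : p = x ∧ q = nxt x
      · simp only [hp, and_self, if_true]; lia
      · simp only [hp, if_false, add_zero]
  · unfold pull
    rw [if_neg (by rintro ⟨rfl, rfl⟩; lia), h.low v w (by lia) (by lia)]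
  · have := h.use v w
    simp only [hinf]
    unfold pull
    by_cases hp : v = x ∧ w = nxt x
    · obtain ⟨rfl, rfl⟩ := hp
      simp only [hex, if_false, and_self, if_true, true_or] at this ⊢
      lia
    · simpa only [hp, if_false, false_or] using this
  · have := h.head
    rw [List.head?_append, this]; rfl
  · rw [List.pairwise_append]
    refine ⟨h.pairwise, by simp, fun v hv w hw => ?_⟩
    rw [List.mem_singleton.1 hw]
    have := hd v hv; lia
  · rw [List.isChain_append]
    refine ⟨h.chain, by simp, fun v hv w hw => ?_⟩
    rw [h.last] at hv
    simp only [Option.mem_def, Option.some.injEq, List.head?_cons] at hv hw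
    subst hv hw
    exact h₂
  · have := h.length
    simp only [List.length_append, List.length_singleton] at this ⊢
    lia

theorem exists_crossing {X : Finset α} {P : List α} {a b : α} (ha : P.head? = some a)
    (hb : P.getLast? = some b) (haX : a ∈ X) (hbX : b ∉ X) :
    ∃ v ∈ X, ∃ w ∉ X, [v, w] <:+: P := by
  induction P generalizing a with
  | nil => simp at ha
  | cons x P ih =>
    obtain rfl : x = a := by simpa using ha
    cases P with
    | nil =>
      obtain rfl : x = b := by simpa using hb
      exact absurd haX hbX
    | cons y P =>
      by_cases hy : y ∈ X
      · obtain ⟨v, hv, w, hw, h⟩ := ih rfl (by simpa using hb) hy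
        exact ⟨v, hv, w, hw, h.trans (List.suffix_cons _ _).isInfix⟩
      · exact ⟨x, haX, y, hy, ⟨[], P, by simp⟩⟩

end Tree

end FlowNet

/-! # Programs for the search for paths -/

namespace RAM

theorem Store.get_set (σ : Store) (t i j v t' i' j' : ℕ) :
    σ.set t i j v t' i' j' = if t' = t ∧ i' = i ∧ j' = j then v else σ t' i' j' := rfl

namespace Term

def var (t : ℕ) : Term := .cell t (.const 0) (.const 0)
def arr (t : ℕ) (i : Term) : Term := .cell t i (.const 0)
def add (a b : Term) : Term := .bin .add a b
def sub (a b : Term) : Term := .bin .sub a b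
def mul (a b : Term) : Term := .bin .mul a b
def div (a b : Term) : Term := .bin .div a b
/-- The remainder of `a` modulo `b`. -/
def rem (a b : Term) : Term := .sub a (.mul (.div a b) b)
-- Truth means being nonzero, so truncated subtraction decides strict inequality, and `mul` and
-- `add` act as conjunction and disjunction.
def lt (a b : Term) : Term := .sub b a
def not (a : Term) : Term := .sub (.const 1) a
def eq (a b : Term) : Term := .not (.add (.sub a b) (.sub b a))

variable (l : List ℕ) (σ : Store)

/-- A term is true if its value is nonzero. -/
def Holds (e : Term) : Prop := e.eval l σ ≠ 0

variable (a b : Term) (t n : ℕ)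

@[simp] theorem eval_const : (const n).eval l σ = n := rfl
@[simp] theorem eval_len : len.eval l σ = l.length := rfl
@[simp] theorem eval_inp : (inp a).eval l σ = l.getD (a.eval l σ) 0 := rfl
@[simp] theorem eval_cell : (cell t a b).eval l σ = σ t (a.eval l σ) (b.eval l σ) := rfl
@[simp] theorem eval_var : (var t).eval l σ = σ t 0 0 := rfl
@[simp] theorem eval_arr : (arr t a).eval l σ = σ t (a.eval l σ) 0 := rfl
@[simp] theorem eval_add : (add a b).eval l σ = a.eval l σ + b.eval l σ := rfl
@[simp] theorem eval_sub : (sub a b).eval l σ = a.eval l σ - b.eval l σ := rfl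
@[simp] theorem eval_mul : (mul a b).eval l σ = a.eval l σ * b.eval l σ := rfl
@[simp] theorem eval_div : (div a b).eval l σ = a.eval l σ / b.eval l σ := rfl
@[simp] theorem eval_rem : (rem a b).eval l σ = a.eval l σ % b.eval l σ := by
  simp [rem, Nat.mod_eq_sub_div_mul]
@[simp] theorem eval_eq : (eq a b).eval l σ = if a.eval l σ = b.eval l σ then 1 else 0 := by
  simp only [eq, not, eval_sub, eval_const, eval_add]; split_ifs <;> lia

@[simp] theorem holds_lt : (lt a b).Holds l σ ↔ a.eval l σ < b.eval l σ := by
  simp only [Holds, lt, eval_sub]; lia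
@[simp] theorem holds_not : (not a).Holds l σ ↔ ¬ a.Holds l σ := by
  simp only [Holds, not, eval_sub, eval_const]; lia
@[simp] theorem holds_eq : (eq a b).Holds l σ ↔ a.eval l σ = b.eval l σ := by
  simp only [Holds, eval_eq]; split_ifs <;> simp_all
@[simp] theorem holds_mul : (mul a b).Holds l σ ↔ a.Holds l σ ∧ b.Holds l σ := by
  simp [Holds]
@[simp] theorem holds_add : (add a b).Holds l σ ↔ a.Holds l σ ∨ b.Holds l σ := by
  simp only [Holds, eval_add]; lia
@[simp] theorem holds_cell : (cell t a b).Holds l σ ↔ σ t (a.eval l σ) (b.eval l σ) ≠ 0 := Iff.rfl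
@[simp] theorem holds_var : (var t).Holds l σ ↔ σ t 0 0 ≠ 0 := Iff.rfl
@[simp] theorem holds_arr : (arr t a).Holds l σ ↔ σ t (a.eval l σ) 0 ≠ 0 := Iff.rfl

end Term

theorem Cmd.exec_ite_pos {l : List ℕ} {σ : Store} {e : Term} (c d : Cmd) (h : e.Holds l σ) :
    (Cmd.ite e c d).exec l σ = c.exec l σ := if_pos h

theorem Cmd.exec_ite_neg {l : List ℕ} {σ : Store} {e : Term} (c d : Cmd) (h : ¬ e.Holds l σ) :
    (Cmd.ite e c d).exec l σ = d.exec l σ := if_neg h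

theorem Cmd.exec_seq (l : List ℕ) (σ : Store) (c d : Cmd) :
    (Cmd.seq c d).exec l σ = d.exec l (c.exec l σ) := rfl

theorem Cmd.exec_assign (l : List ℕ) (σ : Store) (t : ℕ) (i j e : Term) :
    (Cmd.assign t i j e).exec l σ = σ.set t (i.eval l σ) (j.eval l σ) (e.eval l σ) := rfl

/-- Invariant rule for loops. -/
theorem Cmd.exec_loop_induction {l : List ℕ} {σ : Store} {x : ℕ} {c : Cmd} (P : ℕ → Store → Prop)
    (h₀ : P 0 σ) (h : ∀ i τ, i < l.length → P i τ → P (i + 1) (c.exec l (τ.set x 0 0 i))) :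
    P l.length ((Cmd.loop x c).exec l σ) :=
  iter_induction P _ h₀ h

end RAM

namespace UFCS

open RAM

infixr:60 " ;; " => Cmd.seq

-- Arrays and variables of the solver

notation "aOut" => (0 : ℕ)
notation "aOutLen" => (1 : ℕ)
notation "aFlow" => (2 : ℕ)
notation "aVis" => (3 : ℕ)
notation "aNxt" => (4 : ℕ)
notation "aDst" => (5 : ℕ)
notation "aDone" => (6 : ℕ)
notation "aAcc" => (7 : ℕ)
notation "aBest" => (8 : ℕ)
notation "aCur" => (9 : ℕ)
notation "aX" => (10 : ℕ)
notation "aY" => (11 : ℕ)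
notation "aRound" => (12 : ℕ)
notation "aJ" => (13 : ℕ)

/-- `var t := e` -/
def setVar (t : ℕ) (e : Term) : Cmd := .assign t (.const 0) (.const 0) e

/-- `arr t i := e` -/
def setArr (t : ℕ) (i e : Term) : Cmd := .assign t i (.const 0) e

theorem exec_setVar (l : List ℕ) (σ : Store) (t : ℕ) (e : Term) :
    (setVar t e).exec l σ = σ.set t 0 0 (e.eval l σ) := rfl

theorem exec_setArr (l : List ℕ) (σ : Store) (t : ℕ) (i e : Term) :
    (setArr t i e).exec l σ = σ.set t (i.eval l σ) 0 (e.eval l σ) := rfl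

/-- The number of satellites. -/
def satT : Term := .inp (.const 0)

/-- The number of nodes. -/
def nodesT : Term := .mul (.inp (.const 0)) (.inp (.const 1))

/-- The sink. -/
def sinkT : Term := .add (.mul (.sub (.inp (.const 1)) (.const 1)) satT) (.inp (.const 2))

/-- The test whether the search can visit the node `aX` by the arc to the visited node `aY`. -/
def visitCond (A : Term) : Term :=
  .mul (.mul (.lt (.var aX) nodesT) (.lt (.var aY) nodesT))
    (.mul (.mul (.not (.arr aVis (.var aX))) (.arr aVis (.var aY))) A)

def visit (A : Term) : Cmd :=
  .ite (visitCond A)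
    (setArr aVis (.var aX) (.const 1) ;; setArr aNxt (.var aX) (.var aY) ;;
      setArr aDst (.var aX) (.add (.arr aDst (.var aY)) (.const 1)))
    .skip

/-- Backward search from the sink along the arcs from `aX` to `aY` for which `A` holds. -/
def search (A : Term) : Cmd :=
  .loop aX (setArr aVis (.var aX) (.const 0)) ;;
  setArr aVis sinkT (.const 1) ;;
  setArr aDst sinkT (.const 0) ;;
  .loop aRound (.loop aX (.loop aY (visit A)))

section Search

variable {A : ℕ → ℕ → Prop} {V snk : ℕ} {F : ℕ → ℕ → ℕ} {τ₀ τ : Store} {l : List ℕ} {e : Term}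

/-- The term `e` decides the relation `A` if the flow is `F`. -/
def Decides (l : List ℕ) (F : ℕ → ℕ → ℕ) (V : ℕ) (e : Term) (A : ℕ → ℕ → Prop) : Prop :=
  ∀ σ : Store, σ aFlow = F → σ aX 0 0 < V → σ aY 0 0 < V →
    (e.Holds l σ ↔ A (σ aX 0 0) (σ aY 0 0))

/-- A search resets `aVis` everywhere but `aDst` only at the sink. Stale entries of `aNxt` and
`aDst` are harmless, since `next` speaks of visited nodes only. -/
structure SearchInv (A : ℕ → ℕ → Prop) (V snk : ℕ) (F : ℕ → ℕ → ℕ) (τ : Store) : Prop where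
  flow : τ aFlow = F
  root : τ aVis snk 0 ≠ 0
  dst_root : τ aDst snk 0 = 0
  next : ∀ v < V, τ aVis v 0 ≠ 0 → v ≠ snk → τ aNxt v 0 < V ∧ τ aVis (τ aNxt v 0) 0 ≠ 0 ∧
    A v (τ aNxt v 0) ∧ τ aDst v 0 = τ aDst (τ aNxt v 0) 0 + 1

theorem SearchInv.set_var (h : SearchInv A V snk F τ) {t : ℕ} (ht : 5 < t) (i j k : ℕ) :
    SearchInv A V snk F (τ.set t i j k) := by
  have e : ∀ t' ≤ 5, τ.set t i j k t' = τ t' := fun t' ht' => Store.set_of_ne _ (by lia) _ _ _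
  exact ⟨by rw [e _ (by lia)]; exact h.flow, by rw [e _ (by lia)]; exact h.root, by
    rw [e _ (by lia)]; exact h.dst_root, by
    rw [e _ (by lia), e _ (by lia), e _ (by lia)]; exact h.next⟩

def visited (τ : Store) (x y : ℕ) : Store :=
  ((τ.set aVis x 0 1).set aNxt x 0 y).set aDst x 0 (τ aDst y 0 + 1)

theorem visited_vis (τ : Store) (x y v : ℕ) :
    visited τ x y aVis v 0 = if v = x then 1 else τ aVis v 0 := by
  simp [visited, Store.get_set]

theorem visited_nxt (τ : Store) (x y v : ℕ) :
    visited τ x y aNxt v 0 = if v = x then y else τ aNxt v 0 := by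
  simp [visited, Store.get_set]

theorem visited_dst (τ : Store) (x y v : ℕ) :
    visited τ x y aDst v 0 = if v = x then τ aDst y 0 + 1 else τ aDst v 0 := by
  simp [visited, Store.get_set]

theorem visited_of_notMem (τ : Store) (x y : ℕ) {t : ℕ} (h : t ∉ [aVis, aNxt, aDst]) :
    visited τ x y t = τ t := by
  simp only [List.mem_cons, List.not_mem_nil, or_false, not_or] at h
  unfold visited
  rw [Store.set_of_ne _ h.2.2, Store.set_of_ne _ h.2.1, Store.set_of_ne _ h.1]

theorem SearchInv.visited (h : SearchInv A V snk F τ) {x y : ℕ} (hy : y < V)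
    (hvx : τ aVis x 0 = 0) (hvy : τ aVis y 0 ≠ 0) (hA : A x y) :
    SearchInv A V snk F (visited τ x y) where
  flow := by rw [visited_of_notMem _ _ _ (by simp)]; exact h.flow
  root := by
    rw [visited_vis]; split
    · exact one_ne_zero
    · exact h.root
  dst_root := by
    rw [visited_dst, if_neg (by rintro rfl; exact h.root hvx)]; exact h.dst_root
  next v hv hvis hvs := by
    have hyx : y ≠ x := by rintro rfl; exact hvy hvx
    simp only [visited_vis, visited_nxt, visited_dst] at hvis ⊢
    by_cases hvx' : v = x
    · subst hvx'
      simp [hyx, hy, hvy, hA]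
    · rw [if_neg hvx'] at hvis ⊢
      obtain ⟨h₁, h₂, h₃, h₄⟩ := h.next v hv hvis hvs
      have hne : τ aNxt v 0 ≠ x := by intro e; rw [e] at h₂; exact h₂ hvx
      simp only [hne, hvx', if_false]
      exact ⟨h₁, h₂, h₃, h₄⟩

/-- Here `p` holds for the pairs scanned so far, and `τ₀` is the store at the start of the round. By
`stay` and `prog`, a full round that adds no node proves closedness, and a round from a closed set
adds none. -/
structure RoundInv (A : ℕ → ℕ → Prop) (V snk : ℕ) (F : ℕ → ℕ → ℕ) (τ₀ : Store)
    (p : ℕ → ℕ → Prop) (τ : Store) : Prop where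
  inv : SearchInv A V snk F τ
  mono : ∀ v, τ₀ aVis v 0 ≠ 0 → τ aVis v 0 ≠ 0
  stay : (∀ v < V, ∀ w < V, τ₀ aVis w 0 ≠ 0 → A v w → τ₀ aVis v 0 ≠ 0) →
    ∀ v < V, τ aVis v 0 ≠ 0 → τ₀ aVis v 0 ≠ 0
  prog : ∀ v < V, ∀ w < V, p v w → τ₀ aVis w 0 ≠ 0 → A v w → τ aVis v 0 ≠ 0

theorem RoundInv.set_var {p : ℕ → ℕ → Prop} (h : RoundInv A V snk F τ₀ p τ) {t : ℕ} (ht : 5 < t)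
    (i j k : ℕ) : RoundInv A V snk F τ₀ p (τ.set t i j k) := by
  have e : τ.set t i j k aVis = τ aVis := Store.set_of_ne _ (by lia) _ _ _
  exact ⟨h.inv.set_var ht i j k, by rw [e]; exact h.mono, by rw [e]; exact h.stay,
    by rw [e]; exact h.prog⟩

theorem RoundInv.visit {p : ℕ → ℕ → Prop} (he : Decides l F V e A)
    (hV : ∀ σ, nodesT.eval l σ = V) (h : RoundInv A V snk F τ₀ p τ) :
    RoundInv A V snk F τ₀ (fun v w => p v w ∨ (v = τ aX 0 0 ∧ w = τ aY 0 0))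
      ((visit e).exec l τ) := by
  by_cases hc : (visitCond e).Holds l τ
  · rw [UFCS.visit, Cmd.exec_ite_pos _ _ hc]
    simp only [visitCond, Term.holds_mul, Term.holds_lt, Term.eval_var, hV, Term.holds_not,
      Term.holds_arr, not_not] at hc
    obtain ⟨⟨hx, hy⟩, ⟨hvx, hvy⟩, hA⟩ := hc
    rw [he τ h.inv.flow hx hy] at hA
    have e₀ : (setArr aVis (.var aX) (.const 1) ;; setArr aNxt (.var aX) (.var aY) ;;
        setArr aDst (.var aX) (.add (.arr aDst (.var aY)) (.const 1))).exec l τ =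
        visited τ (τ aX 0 0) (τ aY 0 0) := by
      simp [Cmd.exec_seq, exec_setArr, visited, Store.get_set]
    rw [e₀]
    refine ⟨h.inv.visited hy hvx hvy hA, fun v hv => ?_, fun hcl v hv hv' => ?_,
      fun v hv w hw hp hvw hAvw => ?_⟩
    · rw [visited_vis]; split
      · exact one_ne_zero
      · exact h.mono v hv
    · exact absurd hvx (h.mono _ (hcl _ hx _ hy (h.stay hcl _ hy hvy) hA))
    · rw [visited_vis]; split_ifs with hvx'
      · exact one_ne_zero
      · exact h.prog v hv w hw (hp.resolve_right fun h' => hvx' h'.1) hvw hAvw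
  · rw [UFCS.visit, Cmd.exec_ite_neg _ _ hc]
    refine ⟨h.inv, h.mono, h.stay, fun v hv w hw hp hvw hAvw => ?_⟩
    rcases hp with hp | ⟨rfl, rfl⟩
    · exact h.prog v hv w hw hp hvw hAvw
    · simp only [visitCond, Term.holds_mul, Term.holds_lt, Term.eval_var, hV, Term.holds_not,
        Term.holds_arr, not_not] at hc
      intro hvx
      exact hc ⟨⟨hv, hw⟩, ⟨hvx, h.mono _ hvw⟩, (he τ h.inv.flow hv hw).2 hAvw⟩

theorem RoundInv.round (he : Decides l F V e A) (hV : ∀ σ, nodesT.eval l σ = V)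
    (hVl : V ≤ l.length) (h : SearchInv A V snk F τ₀) :
    RoundInv A V snk F τ₀ (fun _ _ => True) ((Cmd.loop aX (.loop aY (UFCS.visit e))).exec l τ₀) := by
  have := Cmd.exec_loop_induction (l := l) (σ := τ₀) (x := aX) (c := .loop aY (UFCS.visit e))
    (fun x τ => RoundInv A V snk F τ₀ (fun v _ => v < x) τ)
    ⟨h, fun _ h => h, fun _ _ _ h => h, fun _ _ _ _ h => absurd h (Nat.not_lt_zero _)⟩ ?_
  · exact ⟨this.inv, this.mono, this.stay, fun v hv w hw _ =>
      this.prog v hv w hw (by lia)⟩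
  intro x τ hx hτ
  have := Cmd.exec_loop_induction (l := l) (σ := τ.set aX 0 0 x) (x := aY) (c := UFCS.visit e)
    (fun y τ => τ aX 0 0 = x ∧ RoundInv A V snk F τ₀ (fun v w => v < x ∨ (v = x ∧ w < y)) τ)
    ⟨by simp [Store.get_set], ?_⟩ ?_
  · refine ⟨this.2.inv, this.2.mono, this.2.stay, fun v hv w hw hvx =>
      this.2.prog v hv w hw ?_⟩
    lia
  · have := hτ.set_var (t := aX) (by lia) 0 0 x
    exact ⟨this.inv, this.mono, this.stay, fun v hv w hw hp => this.prog v hv w hw (by lia)⟩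
  · rintro y τ hy ⟨hτx, hτ⟩
    have e₁ : τ.set aY 0 0 y aX 0 0 = x := by simpa [Store.get_set] using hτx
    refine ⟨?_, ?_⟩
    · rw [Cmd.exec_of_notMem _ _ _ (by simp [UFCS.visit, setArr, Cmd.writes]), e₁]
    · have := (hτ.set_var (t := aY) (by lia) 0 0 y).visit he hV
      rw [e₁] at this
      simp only [Store.get_set, and_self, if_true] at this
      exact ⟨this.inv, this.mono, this.stay, fun v hv w hw hp => this.prog v hv w hw (by lia)⟩

/-- The search builds a tree that spans all nodes from which the sink can be reached. -/
theorem exec_search (he : Decides l F V e A) (hV : ∀ σ, nodesT.eval l σ = V)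
    (hsnk : ∀ σ, sinkT.eval l σ = snk) (hsV : snk < V) (hVl : V ≤ l.length) (σ : Store)
    (hF : σ aFlow = F) :
    SearchInv A V snk F ((search e).exec l σ) ∧
      ∀ v < V, ∀ w < V, (search e).exec l σ aVis w 0 ≠ 0 → A v w →
        (search e).exec l σ aVis v 0 ≠ 0 := by
  simp only [search, Cmd.exec_seq]
  set σ₁ := (Cmd.loop aX (setArr aVis (.var aX) (.const 0))).exec l σ with hσ₁
  have h₁ : ∀ v < V, σ₁ aVis v 0 = 0 := by
    have := Cmd.exec_loop_induction (l := l) (σ := σ) (x := aX)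
      (c := setArr aVis (.var aX) (.const 0)) (fun x τ => ∀ v < x, τ aVis v 0 = 0) (by lia) ?_
    · exact fun v hv => this v (by lia)
    intro x τ hx hτ v hv
    rw [exec_setArr, Store.get_set]
    simp only [Term.eval_var, Term.eval_const, Store.get_set]
    simp only [and_self, if_true, true_and, and_true]
    split_ifs with h h'
    · rfl
    · lia
    · exact hτ v (by lia)
  have h₁F : σ₁ aFlow = F := by
    rw [hσ₁, Cmd.exec_of_notMem _ _ _ (by simp [setArr, Cmd.writes]), hF]
  rw [exec_setArr, exec_setArr]
  simp only [hsnk, Term.eval_const]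
  set σ₂ := (σ₁.set aVis snk 0 1).set aDst snk 0 0 with hσ₂
  have h₂ : SearchInv A V snk F σ₂ := by
    refine ⟨?_, by simp [hσ₂, Store.get_set], by simp [hσ₂, Store.get_set], fun v hv hvis hvs => ?_⟩
    · rw [hσ₂, Store.set_of_ne _ (by lia), Store.set_of_ne _ (by lia), h₁F]
    · simp [hσ₂, Store.get_set, hvs, h₁ v hv] at hvis
  let vs : Store → Finset ℕ := fun τ => (Finset.range V).filter fun v => τ aVis v 0 ≠ 0
  -- After `r` rounds the visited set is closed or has at least `r + 1` elements. As `V ≤ l.length`,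
  -- the second alternative fails at the end.
  have main := Cmd.exec_loop_induction (l := l) (σ := σ₂) (x := aRound)
    (c := .loop aX (.loop aY (visit e)))
    (fun r τ => SearchInv A V snk F τ ∧
      ((∀ v < V, ∀ w < V, τ aVis w 0 ≠ 0 → A v w → τ aVis v 0 ≠ 0) ∨ r + 1 ≤ (vs τ).card))
    ⟨h₂, Or.inr ?_⟩ ?_
  · refine ⟨main.1, main.2.resolve_right fun h => ?_⟩
    have : (vs ((Cmd.loop aRound (.loop aX (.loop aY (visit e)))).exec l σ₂)).card ≤ V :=
      (Finset.card_filter_le _ _).trans (Finset.card_range V).le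
    lia
  · exact Finset.card_pos.2 ⟨snk, by simpa [vs, hsV] using h₂.root⟩
  · rintro r τ hr ⟨hτ, hcl⟩
    have ev : τ.set aRound 0 0 r aVis = τ aVis := Store.set_of_ne _ (by lia) _ _ _
    have h₃ := RoundInv.round he hV hVl (hτ.set_var (t := aRound) (by lia) 0 0 r)
    set τ' := (Cmd.loop aX (.loop aY (visit e))).exec l (τ.set aRound 0 0 r)
    have hmono := h₃.mono
    have hstay := h₃.stay
    have hprog := h₃.prog
    rw [ev] at hmono hstay hprog
    refine ⟨h₃.inv, ?_⟩
    by_cases hsub : ∀ v < V, τ' aVis v 0 ≠ 0 → τ aVis v 0 ≠ 0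
    · exact Or.inl fun v hv w hw hvw hA => hprog v hv w hw trivial (hsub w hw hvw) hA
    · refine Or.inr ?_
      have hcard := hcl.resolve_left fun h => hsub (hstay h)
      push Not at hsub
      obtain ⟨v, hv, hv₁, hv₂⟩ := hsub
      have : vs τ ⊂ vs τ' := by
        refine (Finset.ssubset_iff_of_subset fun w hw => ?_).2 ⟨v, ?_, ?_⟩
        · simp only [vs, Finset.mem_filter] at hw ⊢
          exact ⟨hw.1, hmono w hw.2⟩
        · simpa [vs, hv] using hv₁
        · simp [vs, hv₂]
      have := Finset.card_lt_card this
      lia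

end Search

end UFCS

/-! # Instances and their encodings -/

namespace UFCS

open RAM

theorem mul_add_lt_mul {a b m r : ℕ} (ha : a < b) (hr : r < m) : a * m + r < b * m :=
  calc a * m + r < (a + 1) * m := by lia
    _ ≤ b * m := Nat.mul_le_mul_right _ ha

theorem length_flatMap_finRange {n m : ℕ} {f : Fin n → List ℕ} (hf : ∀ i, (f i).length = m) :
    ((List.finRange n).flatMap f).length = n * m := by
  simp [List.length_flatMap, hf]

theorem getD_flatMap_finRange {n m : ℕ} {f : Fin n → List ℕ} (hf : ∀ i, (f i).length = m)
    (i : Fin n) {r : ℕ} (hr : r < m) :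
    ((List.finRange n).flatMap f).getD (i * m + r) 0 = (f i).getD r 0 := by
  induction n with
  | zero => exact i.elim0
  | succ n ih =>
    rw [List.finRange_succ, List.flatMap_cons, List.flatMap_map]
    refine Fin.cases ?_ (fun i => ?_) i
    · rw [List.getD_append _ _ _ _ (by simpa [hf] using hr)]
      simp
    · have e : (i.succ : ℕ) * m + r = m + (i * m + r) := by
        simp only [Fin.val_succ]; ring
      rw [e, List.getD_append_right _ _ _ _ (by rw [hf]; lia), hf, Nat.add_sub_cancel_left]
      exact ih (fun i => hf i.succ) i

namespace Instance

variable (G : Instance)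

theorem I_pos : 0 < G.I := G.s.pos

/-- The number of a node. -/
def code (v : G.Node) : ℕ := v.2 * G.I + v.1

/-- The node with a given number. -/
def decode (x : ℕ) : G.Node :=
  (⟨x % G.I, Nat.mod_lt _ G.I_pos⟩, ⟨x / G.I % G.K, Nat.mod_lt _ G.K_pos⟩)

theorem code_div (v : G.Node) : G.code v / G.I = v.2 := by
  rw [code, add_comm, Nat.add_mul_div_right _ _ G.I_pos, Nat.div_eq_of_lt v.1.2, zero_add]

theorem code_mod (v : G.Node) : G.code v % G.I = v.1 := by
  rw [code, add_comm, Nat.add_mul_mod_self_right, Nat.mod_eq_of_lt v.1.2]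

theorem code_lt (v : G.Node) : G.code v < G.I * G.K := by
  have h₁ := v.1.2
  have h₂ := v.2.2
  unfold code
  rw [mul_comm G.I]
  exact mul_add_lt_mul h₂ h₁

theorem decode_code (v : G.Node) : G.decode (G.code v) = v := by
  refine Prod.ext (Fin.ext ?_) (Fin.ext ?_)
  · exact G.code_mod v
  · show G.code v / G.I % G.K = v.2
    rw [code_div, Nat.mod_eq_of_lt v.2.2]

theorem code_decode {x : ℕ} (hx : x < G.I * G.K) : G.code (G.decode x) = x := by
  have : x / G.I < G.K := Nat.div_lt_of_lt_mul hx
  show x / G.I % G.K * G.I + x % G.I = x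
  rw [Nat.mod_eq_of_lt this, Nat.div_add_mod']

theorem code_inj {v w : G.Node} : G.code v = G.code w ↔ v = w :=
  ⟨fun h => by rw [← G.decode_code v, h, decode_code], fun h => by rw [h]⟩

/-! ## Reading the encoding -/

def capCode (k : Fin G.K) (i j : Fin G.I) : List ℕ :=
  match G.cap k i j with
  | none => [0, 0, 1]
  | some p => [1, p.num, p.den]

def clientCode (i : Fin G.I) : List ℕ :=
  if h : i ∈ G.C then
    [1, (G.κ ⟨i, h⟩).val, if G.u ⟨i, h⟩ < 0 then 1 else 0,
      (G.u ⟨i, h⟩).num.natAbs, (G.u ⟨i, h⟩).den]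
  else [0, 0, 0, 0, 1]

theorem length_capCode (k : Fin G.K) (i j : Fin G.I) : (G.capCode k i j).length = 3 := by
  unfold capCode; split <;> rfl

theorem length_clientCode (i : Fin G.I) : (G.clientCode i).length = 5 := by
  unfold clientCode; split <;> rfl

theorem encode_eq : G.encode = [G.I, G.K, G.s.val, G.q.num, G.q.den] ++
    (((List.finRange G.K).flatMap fun k => (List.finRange G.I).flatMap fun i =>
      (List.finRange G.I).flatMap fun j => G.capCode k i j) ++
    (List.finRange G.I).flatMap fun i => G.clientCode i) := by
  rw [← List.append_assoc]
  unfold encode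
  congr 1

theorem length_caps : ((List.finRange G.K).flatMap fun k => (List.finRange G.I).flatMap fun i =>
    (List.finRange G.I).flatMap fun j => G.capCode k i j).length = G.K * (G.I * (G.I * 3)) :=
  length_flatMap_finRange fun _ => length_flatMap_finRange fun _ =>
    length_flatMap_finRange fun _ => G.length_capCode _ _ _

theorem length_encode : G.encode.length = 5 + 3 * (G.K * G.I * G.I) + 5 * G.I := by
  rw [encode_eq, List.length_append, List.length_append, length_caps,
    length_flatMap_finRange G.length_clientCode]
  simp only [List.length_cons, List.length_nil]
  ring

/-- The capacity table alone has more than `I * K` entries, so loops over the input length are long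
enough to reach every node. -/
theorem nodes_le_length : G.I * G.K ≤ G.encode.length := by
  rw [length_encode]
  have : G.I * G.K * 1 ≤ G.I * G.K * G.I := Nat.mul_le_mul_left _ G.I_pos
  have : G.K * G.I * G.I = G.I * G.K * G.I := by ring
  lia

theorem getD_encode_zero : G.encode.getD 0 0 = G.I := by rw [encode_eq]; rfl
theorem getD_encode_one : G.encode.getD 1 0 = G.K := by rw [encode_eq]; rfl
theorem getD_encode_two : G.encode.getD 2 0 = G.s := by rw [encode_eq]; rfl
theorem getD_encode_three : G.encode.getD 3 0 = G.q.num := by rw [encode_eq]; rfl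
theorem getD_encode_four : G.encode.getD 4 0 = G.q.den := by rw [encode_eq]; rfl

theorem getD_encode_cap (k : Fin G.K) (i j : Fin G.I) {r : ℕ} (hr : r < 3) :
    G.encode.getD (5 + 3 * ((k * G.I + i) * G.I + j) + r) 0 = (G.capCode k i j).getD r 0 := by
  have h₂ : (i : ℕ) * (G.I * 3) + (j * 3 + r) < G.I * (G.I * 3) := by
    exact mul_add_lt_mul i.2 (by have := j.2; lia)
  have h₁ : (k : ℕ) * (G.I * (G.I * 3)) + (i * (G.I * 3) + (j * 3 + r)) <
      G.K * (G.I * (G.I * 3)) := mul_add_lt_mul k.2 h₂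
  have e : 5 + 3 * ((k * G.I + i) * G.I + j) + r =
      5 + ((k : ℕ) * (G.I * (G.I * 3)) + (i * (G.I * 3) + (j * 3 + r))) := by ring
  rw [encode_eq, e, List.getD_append_right _ _ _ _ (by simp)]
  simp only [List.length_cons, List.length_nil, zero_add, Nat.reduceAdd, Nat.add_sub_cancel_left]
  rw [List.getD_append _ _ _ _ (by rwa [length_caps]),
    getD_flatMap_finRange (fun _ => length_flatMap_finRange fun _ =>
      length_flatMap_finRange fun _ => G.length_capCode _ _ _) k h₂,
    getD_flatMap_finRange (fun _ => length_flatMap_finRange fun _ => G.length_capCode _ _ _) i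
      (by have := j.2; lia),
    getD_flatMap_finRange (fun _ => G.length_capCode _ _ _) j hr]

theorem getD_encode_client (i : Fin G.I) {r : ℕ} (hr : r < 5) :
    G.encode.getD (5 + 3 * (G.K * G.I * G.I) + 5 * i + r) 0 = (G.clientCode i).getD r 0 := by
  have e : 5 + 3 * (G.K * G.I * G.I) + 5 * (i : ℕ) + r =
      5 + (G.K * (G.I * (G.I * 3)) + (i * 5 + r)) := by ring
  rw [encode_eq, e, List.getD_append_right _ _ _ _ (by simp)]
  simp only [List.length_cons, List.length_nil, zero_add, Nat.reduceAdd, Nat.add_sub_cancel_left]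
  rw [List.getD_append_right _ _ _ _ (by rw [length_caps]; lia), length_caps,
    Nat.add_sub_cancel_left, getD_flatMap_finRange G.length_clientCode i hr]

theorem getD_clientCode_zero (i : Fin G.I) : (G.clientCode i).getD 0 0 ≠ 0 ↔ i ∈ G.C := by
  unfold clientCode; split <;> simp_all

theorem getD_clientCode_one (c : G.Client) : (G.clientCode c.1).getD 1 0 = G.κ c := by
  simp [clientCode, c.2]

theorem getD_clientCode_two (c : G.Client) : (G.clientCode c.1).getD 2 0 ≠ 0 ↔ G.u c < 0 := by
  by_cases h : G.u c < 0 <;> simp [clientCode, c.2, h]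

theorem getD_clientCode_three (c : G.Client) :
    (G.clientCode c.1).getD 3 0 = (G.u c).num.natAbs := by
  simp [clientCode, c.2]

theorem getD_clientCode_four (c : G.Client) : (G.clientCode c.1).getD 4 0 = (G.u c).den := by
  simp [clientCode, c.2]

/-! ## Integral capacities -/

/-- The number of models that an arc can carry; for caching arcs, a number that suffices. -/
def ucap (v w : G.Node) : ℕ :=
  if v.2 = w.2 then
    match G.cap v.2 v.1 w.1 with
    | none => 0
    | some p => p.num * G.q.den / (p.den * G.q.num)
  else if v.1 = w.1 ∧ v.2.val + 1 = w.2.val then G.encode.length else 0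

/-- The right-hand side is `⌊p / q⌋`: here the common model size turns rational capacities into
integral ones. -/
theorem q_mul_le_iff (p : ℚ≥0) (k : ℕ) :
    G.q * (k : ℚ≥0) ≤ p ↔ k ≤ p.num * G.q.den / (p.den * G.q.num) := by
  have hq : 0 < G.q.num := NNRat.num_pos.2 G.q_pos
  have hpd := p.den_pos
  have hqd := G.q.den_pos
  rw [Nat.le_div_iff_mul_le (by positivity)]
  conv_lhs => rw [← NNRat.num_div_den G.q, ← NNRat.num_div_den p]
  rw [div_mul_eq_mul_div, div_le_div_iff₀ (by exact_mod_cast hqd) (by exact_mod_cast hpd)]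
  norm_cast
  rw [show k * (p.den * G.q.num) = G.q.num * k * p.den by ring]

theorem card_C_le : G.C.card ≤ G.encode.length := by
  have := Finset.card_le_univ G.C
  rw [Fintype.card_fin] at this
  rw [length_encode]; lia

theorem usage_le (R : G.Routing) (v w : G.Node) : G.usage R v w ≤ G.C.card := by
  unfold usage
  refine (Finset.card_le_univ _).trans ?_
  simp

/-- `ucap` overestimates caching arcs; for these the bound comes from `usage_le`, as no more than
`|C|` paths exist. -/
theorem le_of_usage_le_ucap {R : G.Routing} {v w : G.Node} {p : ℚ≥0} (hp : p ∈ G.arcCap v w)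
    (h : G.usage R v w ≤ G.ucap v w) : G.q * (G.usage R v w : ℚ≥0) ≤ p := by
  unfold arcCap at hp
  unfold ucap at h
  split_ifs at hp h with h₁ h₂
  · rw [Option.mem_def] at hp
    rw [hp] at h
    exact (G.q_mul_le_iff p _).2 h
  · simp only [Option.mem_def, Option.some.injEq] at hp
    rw [← hp]
    gcongr
    exact G.usage_le R v w
  · simp at hp

theorem isArc_of_ucap_pos {v w : G.Node} (h : 0 < G.ucap v w) : G.IsArc v w := by
  unfold IsArc arcCap
  unfold ucap at h
  split_ifs at h ⊢ with h₁ h₂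
  · revert h
    split
    · simp
    · next heq => simp [heq]
  · rfl
  · simp at h

theorem usage_le_ucap {R : G.Routing} (hR : G.Feasible R) (v w : G.Node) :
    G.usage R v w ≤ G.ucap v w := by
  by_cases ha : G.IsArc v w
  · obtain ⟨p, hp⟩ := Option.isSome_iff_exists.1 ha
    have hle := hR.2 v w p hp
    unfold arcCap at hp
    unfold ucap
    split_ifs at hp ⊢ with h₁ h₂
    · rw [hp]
      exact (G.q_mul_le_iff p _).1 hle
    · exact (G.usage_le R v w).trans G.card_C_le
  · have : G.usage R v w = 0 := by
      unfold usage
      rw [Finset.card_eq_zero, Finset.filter_eq_empty_iff]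
      rintro c - ⟨P, hP, hi⟩
      have := ((hR.1 c P hP).2.2.2).infix hi
      simp only [List.isChain_pair] at this
      exact ha this
    lia

open Classical in
/-- The selected clients of a feasible solution respect all cuts. -/
theorem Feasible.cutCond {R : G.Routing} (hR : G.Feasible R) :
    FlowNet.CutCond G.ucap G.sink G.source {c | (R c).isSome} := by
  intro X hX
  refine le_trans ?_ (Finset.sum_le_sum fun v _ => Finset.sum_le_sum fun w _ =>
    G.usage_le_ucap hR v w)
  rw [← Finset.sum_product']
  -- Each selected path starting in `X` uses some arc leaving `X`, so these clients are covered by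
  -- the users of the arcs of the cut.
  have hsub : ({c ∈ ({c | (R c).isSome} : Finset G.Client) | G.source c ∈ X} : Finset G.Client) ⊆
      (X ×ˢ Xᶜ).biUnion fun a =>
        Finset.univ.filter fun c : G.Client => ∃ P ∈ R c, [a.1, a.2] <:+: P := by
    intro c hc
    simp only [Finset.mem_filter, Finset.mem_univ, true_and] at hc
    obtain ⟨P, hP⟩ := Option.isSome_iff_exists.1 hc.1
    obtain ⟨h₁, h₂, -, -⟩ := hR.1 c P hP
    obtain ⟨v, hv, w, hw, hi⟩ := FlowNet.exists_crossing h₁ h₂ hc.2 hX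
    simp only [Finset.mem_biUnion, Finset.mem_filter, Finset.mem_univ, true_and]
    exact ⟨(v, w), by simp [hv, hw], P, hP, hi⟩
  refine (Finset.card_le_card hsub).trans (Finset.card_biUnion_le.trans ?_)
  refine Finset.sum_le_sum fun a _ => ?_
  unfold usage
  exact le_of_eq (congrArg Finset.card (Finset.filter_congr_decidable ..))

end Instance

end UFCS

/-! # The greedy algorithm with augmenting paths -/

namespace UFCS

open RAM FlowNet

/-- The entry `r` of the record of the satellite `i`. -/
def clientT (i : Term) (r : ℕ) : Term :=
  .inp (.add (.add (.add (.const 5) (.mul (.const 3)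
    (.mul (.mul (.inp (.const 1)) satT) satT))) (.mul (.const 5) i)) (.const r))

/-- The source of the client `i`. The subtractions do not change the value, but bound it. -/
def sourceT (i : Term) : Term := .sub .len (.sub .len (.add (.mul (clientT i 1) satT) i))

/-- The entry `r` of the record of the arc from `aX` to `aY`. -/
def arcT (r : ℕ) : Term :=
  .inp (.add (.add (.const 5) (.mul (.const 3) (.add (.mul (.var aX) satT)
    (.rem (.var aY) satT)))) (.const r))

/-- The integral capacity of the arc from `aX` to `aY`. -/
def ucapT : Term :=
  .add (.mul (.eq (.div (.var aX) satT) (.div (.var aY) satT))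
    (.div (.mul (arcT 1) (.inp (.const 4))) (.mul (arcT 2) (.inp (.const 3)))))
    (.mul (.eq (.add (.var aX) satT) (.var aY)) .len)

def residualT : Term :=
  .add (.lt (.cell aFlow (.var aX) (.var aY)) ucapT) (.cell aFlow (.var aY) (.var aX))

def supportT : Term := .cell aFlow (.var aX) (.var aY)

def nextT : Term := .arr aNxt (.var aCur)

/-- Sends one unit along the arc to the next node. -/
def pushNext : Cmd :=
  .ite (.cell aFlow nextT (.var aCur))
    (.assign aFlow nextT (.var aCur) (.sub (.cell aFlow nextT (.var aCur)) (.const 1)))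
    (.assign aFlow (.var aCur) nextT (.add (.cell aFlow (.var aCur) nextT) (.const 1)))

/-- Sends one unit from the current node to the sink. -/
def augment : Cmd :=
  .loop aRound (.ite (.eq (.var aCur) sinkT) .skip (pushNext ;; setVar aCur nextT))

/-- Appends a number to the output. -/
def emit (e : Term) : Cmd :=
  setArr aOut (.var aOutLen) e ;; setVar aOutLen (.add (.var aOutLen) (.const 1))

def emitNode : Cmd := emit (.rem (.var aCur) satT) ;; emit (.div (.var aCur) satT)

/-- Removes one unit from the current node to the sink and writes down the nodes of its path. -/
def peel : Cmd :=
  .loop aRound (.ite (.eq (.var aCur) sinkT) .skip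
    (.assign aFlow (.var aCur) nextT (.sub (.cell aFlow (.var aCur) nextT) (.const 1)) ;;
      setVar aCur nextT ;; emitNode))

namespace Instance

variable (G : Instance)

theorem satT_eval (σ : Store) : satT.eval G.encode σ = G.I := G.getD_encode_zero

theorem nodesT_eval (σ : Store) : nodesT.eval G.encode σ = G.I * G.K := by
  show G.encode.getD 0 0 * G.encode.getD 1 0 = _
  rw [getD_encode_zero, getD_encode_one]

theorem sinkT_eval (σ : Store) : sinkT.eval G.encode σ = G.code G.sink := by
  show (G.encode.getD 1 0 - 1) * G.encode.getD 0 0 + G.encode.getD 2 0 = _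
  rw [getD_encode_zero, getD_encode_one, getD_encode_two]
  rfl

theorem clientT_eval {σ : Store} {i : Term} {j : Fin G.I} (h : i.eval G.encode σ = j) {r : ℕ}
    (hr : r < 5) : (clientT i r).eval G.encode σ = (G.clientCode j).getD r 0 := by
  simp only [clientT, Term.eval_inp, Term.eval_add, Term.eval_mul, Term.eval_const, h, satT_eval,
    getD_encode_one, G.getD_encode_client j hr]

theorem sourceT_eval {σ : Store} {i : Term} {c : G.Client} (h : i.eval G.encode σ = c.1) :
    (sourceT i).eval G.encode σ = G.code (G.source c) := by
  have h₁ : (.add (.mul (clientT i 1) satT) i : Term).eval G.encode σ = G.code (G.source c) := by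
    simp only [Term.eval_add, Term.eval_mul, G.clientT_eval h (r := 1) (by lia), satT_eval,
      getD_clientCode_one, h]
    rfl
  have h₂ := G.code_lt (G.source c)
  have h₃ := G.nodes_le_length
  rw [sourceT, Term.eval_sub, Term.eval_sub, h₁, Term.eval_len]
  lia

variable {G} {σ τ : Store} {v w : G.Node}

theorem arcT_eval (hv : σ aX 0 0 = G.code v) (hw : σ aY 0 0 = G.code w) {r : ℕ} (hr : r < 3) :
    (arcT r).eval G.encode σ = (G.capCode v.2 v.1 w.1).getD r 0 := by
  simp only [arcT, Term.eval_inp, Term.eval_add, Term.eval_mul, Term.eval_const, Term.eval_var,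
    Term.eval_rem, satT_eval, hv, hw, code_mod]
  exact G.getD_encode_cap v.2 v.1 w.1 hr

/-- At most one summand survives. Node numbers grow by `I` from one snapshot to the next, which
identifies caching arcs, and an absent arc is encoded as the fraction `0 / 1`, giving capacity `0`.
-/
theorem ucapT_eval (hv : σ aX 0 0 = G.code v) (hw : σ aY 0 0 = G.code w) :
    ucapT.eval G.encode σ = G.ucap v w := by
  have hcache : G.code v + G.I = G.code w ↔ v.1 = w.1 ∧ v.2.val + 1 = w.2.val := by
    constructor
    · intro h
      have h₁ := congrArg (· % G.I) h
      have h₂ := congrArg (· / G.I) h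
      simp only [Nat.add_mod_right, Nat.add_div_right _ G.I_pos, code_mod, code_div] at h₁ h₂
      exact ⟨Fin.ext h₁, h₂⟩
    · rintro ⟨h₁, h₂⟩
      unfold code
      rw [← h₂, h₁]; ring
  simp only [ucapT, Term.eval_add, Term.eval_mul, Term.eval_div, Term.eval_eq, Term.eval_var,
    arcT_eval hv hw (r := 1) (by lia), arcT_eval hv hw (r := 2) (by lia), Term.eval_inp,
    Term.eval_const, getD_encode_three, getD_encode_four, satT_eval, hv, hw, code_div, hcache,
    Term.eval_len]
  unfold ucap capCode
  by_cases h₁ : v.2 = w.2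
  · have h₂ : ¬ (v.1 = w.1 ∧ v.2.val + 1 = w.2.val) := by rw [h₁]; lia
    rw [if_pos (congrArg Fin.val h₁), if_neg h₂, if_pos h₁]
    split <;> simp
  · rw [if_neg (fun h => h₁ (Fin.ext h)), if_neg h₁]
    split_ifs <;> simp

/-- A flow stored in an array, as a function on arcs. -/
def flowOf (F : ℕ → ℕ → ℕ) (v w : G.Node) : ℕ := F (G.code v) (G.code w)

theorem flowOf_set (σ : Store) (a b : G.Node) (k : ℕ) :
    flowOf (σ.set aFlow (G.code a) (G.code b) k aFlow) v w =
      if v = a ∧ w = b then k else flowOf (σ aFlow) v w := by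
  simp only [flowOf, Store.get_set, code_inj, true_and]

theorem residualT_holds (hv : σ aX 0 0 = G.code v) (hw : σ aY 0 0 = G.code w) :
    residualT.Holds G.encode σ ↔ Residual G.ucap (flowOf (σ aFlow)) v w := by
  simp only [residualT, Term.holds_add, Term.holds_lt, ucapT_eval hv hw, Term.eval_cell,
    Term.eval_var, Term.holds_cell, hv, hw, Residual, flowOf, Nat.pos_iff_ne_zero]

theorem supportT_holds (hv : σ aX 0 0 = G.code v) (hw : σ aY 0 0 = G.code w) :
    supportT.Holds G.encode σ ↔ 0 < flowOf (σ aFlow) v w := by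
  simp only [supportT, Term.eval_var, Term.holds_cell, hv, hw, flowOf, Nat.pos_iff_ne_zero]

/-! ## Search trees in the store -/

def vis (σ : Store) (v : G.Node) : Prop := σ aVis (G.code v) 0 ≠ 0
def nxt (σ : Store) (v : G.Node) : G.Node := G.decode (σ aNxt (G.code v) 0)
def dst (σ : Store) (v : G.Node) : ℕ := σ aDst (G.code v) 0

theorem search_of_notMem (e : Term) (l : List ℕ) (σ : Store) {t : ℕ}
    (ht : t ∉ [aVis, aNxt, aDst, aX, aY, aRound]) : (search e).exec l σ t = σ t := by
  refine Cmd.exec_of_notMem _ _ _ ?_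
  simp only [search, visit, setArr, Cmd.writes, List.cons_append, List.nil_append, List.mem_cons,
    List.append_nil, List.not_mem_nil, or_false, not_or] at ht ⊢
  tauto

/-- Moves the result of the search from numbers to nodes. The second part is needed because `decode`
inverts `code` only on numbers in range. -/
theorem isTree_search {e : Term} {B : G.Node → G.Node → Prop} (σ : Store)
    (he : ∀ τ : Store, ∀ v w : G.Node, τ aFlow = σ aFlow → τ aX 0 0 = G.code v →
      τ aY 0 0 = G.code w → (e.Holds G.encode τ ↔ B v w)) :
    IsTree B G.sink (vis ((search e).exec G.encode σ)) (nxt ((search e).exec G.encode σ))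
        (dst ((search e).exec G.encode σ)) ∧
      ∀ v : G.Node, vis ((search e).exec G.encode σ) v → v ≠ G.sink →
        G.code (nxt ((search e).exec G.encode σ) v) =
          (search e).exec G.encode σ aNxt (G.code v) 0 := by
  have hdec : Decides G.encode (σ aFlow) (G.I * G.K) e fun x y => B (G.decode x) (G.decode y) :=
    fun τ hF hx hy => he τ _ _ hF (G.code_decode hx).symm (G.code_decode hy).symm
  obtain ⟨h₁, h₂⟩ := exec_search hdec G.nodesT_eval G.sinkT_eval (G.code_lt G.sink)
    G.nodes_le_length σ rfl
  set τ := (search e).exec G.encode σ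
  have hcode : ∀ v : G.Node, vis τ v → v ≠ G.sink → G.code (nxt τ v) = τ aNxt (G.code v) 0 :=
    fun v hv hvs => G.code_decode (h₁.next _ (G.code_lt v) hv (by rwa [Ne, code_inj])).1
  refine ⟨⟨h₁.root, h₁.dst_root, fun v hv hvs => ?_, fun v w hw hB => ?_⟩, hcode⟩
  · obtain ⟨-, a₂, a₃, a₄⟩ := h₁.next _ (G.code_lt v) hv (by rwa [Ne, code_inj])
    unfold vis dst
    rw [hcode v hv hvs]
    rw [decode_code] at a₃
    exact ⟨a₂, a₃, a₄⟩
  · exact h₂ _ (G.code_lt v) _ (G.code_lt w) hw (by rwa [decode_code, decode_code])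

theorem card_node : Fintype.card G.Node = G.I * G.K := by simp

theorem exec_pushNext {x y : G.Node} (hx : σ aCur 0 0 = G.code x)
    (hy : σ aNxt (G.code x) 0 = G.code y) :
    flowOf (G := G) (pushNext.exec G.encode σ aFlow) = push (flowOf (σ aFlow)) x y := by
  have hn : nextT.eval G.encode σ = G.code y := by simp [nextT, hx, hy]
  funext v w
  by_cases hc : (Term.cell aFlow nextT (.var aCur)).Holds G.encode σ
  · rw [pushNext, Cmd.exec_ite_pos _ _ hc]
    simp only [Term.holds_cell, Term.eval_var, hx, hn] at hc
    simp only [Cmd.exec_assign, hn, Term.eval_var, hx, flowOf_set, Term.eval_sub, Term.eval_cell,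
      Term.eval_const]
    unfold push
    rw [if_pos (show flowOf (σ aFlow) y x ≠ 0 from hc)]
    rfl
  · rw [pushNext, Cmd.exec_ite_neg _ _ hc]
    simp only [Term.holds_cell, Term.eval_var, hx, hn] at hc
    simp only [Cmd.exec_assign, hn, Term.eval_var, hx, flowOf_set, Term.eval_add, Term.eval_cell,
      Term.eval_const]
    unfold push
    rw [if_neg (show ¬ flowOf (σ aFlow) y x ≠ 0 from hc)]
    rfl

theorem exec_augment {f₀ : G.Node → G.Node → ℕ} {vis : G.Node → Prop} {nxt : G.Node → G.Node}
    {dst : G.Node → ℕ} (ht : IsTree (Residual G.ucap f₀) G.sink vis nxt dst) (σ : Store)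
    (hnxt : ∀ v, vis v → v ≠ G.sink → σ aNxt (G.code v) 0 = G.code (nxt v)) {a : G.Node}
    (hcur : σ aCur 0 0 = G.code a) (ha : vis a) (hf : flowOf (σ aFlow) = f₀)
    (hle : ∀ v w, f₀ v w ≤ G.ucap v w) :
    Augment G.ucap f₀ vis dst a G.sink (flowOf (augment.exec G.encode σ aFlow)) := by
  -- The distance drops in each round until the sink is reached, after which rounds are idle; `dst
  -- a` is smaller than the number of rounds.
  have main := Cmd.exec_loop_induction (l := G.encode) (σ := σ) (x := aRound)
    (c := .ite (.eq (.var aCur) sinkT) .skip (pushNext ;; setVar aCur nextT))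
    (fun r τ => τ aNxt = σ aNxt ∧ ∃ x : G.Node, τ aCur 0 0 = G.code x ∧
      Augment G.ucap f₀ vis dst a x (flowOf (τ aFlow)) ∧ (x = G.sink ∨ dst x + r ≤ dst a))
    ⟨rfl, a, hcur, by rw [hf]; exact Augment.init ha hle, Or.inr le_rfl⟩ ?_
  · obtain ⟨-, x, -, hx, hr⟩ := main
    have h₁ := ht.dst_lt_card ha
    rw [card_node] at h₁
    have h₂ := G.nodes_le_length
    obtain rfl := hr.resolve_right (by lia)
    exact hx
  · rintro r τ hr ⟨hτn, x, hx, hA, hd⟩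
    have e₁ : τ.set aRound 0 0 r aFlow = τ aFlow := Store.set_of_ne _ (by lia) _ _ _
    have e₂ : τ.set aRound 0 0 r aCur = τ aCur := Store.set_of_ne _ (by lia) _ _ _
    have e₃ : τ.set aRound 0 0 r aNxt = τ aNxt := Store.set_of_ne _ (by lia) _ _ _
    set τ' := τ.set aRound 0 0 r
    by_cases hc : (Term.eq (.var aCur) sinkT).Holds G.encode τ'
    · rw [Cmd.exec_ite_pos _ _ hc]
      simp only [Term.holds_eq, Term.eval_var, e₂, hx, sinkT_eval, code_inj] at hc
      exact ⟨e₃.trans hτn, x, by rw [Cmd.exec, e₂, hx], by rwa [Cmd.exec, e₁], Or.inl hc⟩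
    · rw [Cmd.exec_ite_neg _ _ hc]
      simp only [Term.holds_eq, Term.eval_var, e₂, hx, sinkT_eval, code_inj] at hc
      have hn : τ' aNxt (G.code x) 0 = G.code (nxt x) := by rw [e₃, hτn, hnxt x hA.reached hc]
      have hp := exec_pushNext (σ := τ') (by rw [e₂, hx]) hn
      have fr : ∀ t, t ≠ aFlow → pushNext.exec G.encode τ' t = τ' t := fun t ht =>
        Cmd.exec_of_notMem _ _ _ (by simpa [pushNext, Cmd.writes] using ht)
      rw [Cmd.exec_seq, exec_setVar]
      refine ⟨?_, nxt x, ?_, ?_, ?_⟩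
      · rw [Store.set_of_ne _ (by lia), fr _ (by lia), e₃, hτn]
      · simp [Store.get_set, nextT, fr, e₂, hx, hn]
      · rw [Store.set_of_ne _ (by lia), hp, e₁]
        exact hA.step ht hc
      · have := (ht.next x hA.reached hc).2.2
        have := hd.resolve_left hc
        exact Or.inr (by lia)

/-! ## Output -/

/-- The output written so far is `L`. -/
def OutIs (σ : Store) (L : List ℕ) : Prop :=
  σ aOutLen 0 0 = L.length ∧ ∀ i (h : i < L.length), σ aOut i 0 = L[i]

theorem OutIs.congr {L : List ℕ} (h : OutIs σ L) (h₀ : τ aOut = σ aOut)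
    (h₁ : τ aOutLen = σ aOutLen) : OutIs τ L := by
  unfold OutIs; rw [h₀, h₁]; exact h

theorem OutIs.emit {l L : List ℕ} (h : OutIs σ L) (e : Term) :
    OutIs ((emit e).exec l σ) (L ++ [e.eval l σ]) := by
  simp only [UFCS.emit, Cmd.exec_seq, exec_setArr, exec_setVar, Term.eval_var, Term.eval_add,
    Term.eval_const]
  refine ⟨by simp [Store.get_set, h.1], fun i hi => ?_⟩
  simp only [List.length_append, List.length_singleton] at hi
  simp only [Store.get_set]
  by_cases hi' : i = L.length
  · subst hi'
    simp [h.1]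
  · have hi'' : i < L.length := by lia
    simp only [h.1, hi', show aOut ≠ aOutLen by lia, false_and, and_false, if_false]
    rw [List.getElem_append_left hi'', h.2 i hi'']

theorem exec_emit_of_notMem (l : List ℕ) (σ : Store) (e : Term) {t : ℕ} (ht : t ∉ [aOut, aOutLen]) :
    (emit e).exec l σ t = σ t :=
  Cmd.exec_of_notMem _ _ _ (by simpa [emit, setArr, setVar, Cmd.writes] using ht)

theorem exec_emitNode_of_notMem (l : List ℕ) (σ : Store) {t : ℕ} (ht : t ∉ [aOut, aOutLen]) :
    emitNode.exec l σ t = σ t := by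
  rw [emitNode, Cmd.exec_seq, exec_emit_of_notMem _ _ _ ht, exec_emit_of_notMem _ _ _ ht]

theorem OutIs.emitNode {L : List ℕ} {x : G.Node} (h : OutIs σ L) (hx : σ aCur 0 0 = G.code x) :
    OutIs (emitNode.exec G.encode σ) (L ++ [x.1.val, x.2.val]) := by
  have h₁ := h.emit (l := G.encode) (.rem (.var aCur) satT)
  have h₂ := h₁.emit (l := G.encode) (.div (.var aCur) satT)
  have e : (UFCS.emit (.rem (.var aCur) satT)).exec G.encode σ aCur = σ aCur :=
    exec_emit_of_notMem _ _ _ (by simp)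
  simp only [Term.eval_div, Term.eval_rem, Term.eval_var, satT_eval, e, hx, code_div, code_mod,
    List.append_assoc, List.singleton_append] at h₂
  exact h₂

def pathCode (P : List G.Node) : List ℕ := P.flatMap fun v => [v.1.val, v.2.val]

/-- The same countdown as for `exec_augment`. The first node is written before the loop, which then
emits each node on arrival. -/
theorem exec_peel {f₀ : G.Node → G.Node → ℕ} {vis : G.Node → Prop} {nxt : G.Node → G.Node}
    {dst : G.Node → ℕ} (ht : IsTree (fun v w => 0 < f₀ v w) G.sink vis nxt dst) (σ : Store)
    (hnxt : ∀ v, vis v → v ≠ G.sink → σ aNxt (G.code v) 0 = G.code (nxt v)) {a : G.Node}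
    (hcur : σ aCur 0 0 = G.code a) (ha : vis a) (hf : flowOf (σ aFlow) = f₀) {L : List ℕ}
    (hL : OutIs σ (L ++ [a.1.val, a.2.val])) :
    ∃ P, Peel f₀ vis dst a G.sink P (flowOf (peel.exec G.encode σ aFlow)) ∧
      OutIs (peel.exec G.encode σ) (L ++ pathCode P) := by
  have main := Cmd.exec_loop_induction (l := G.encode) (σ := σ) (x := aRound)
    (c := .ite (.eq (.var aCur) sinkT) .skip
      (.assign aFlow (.var aCur) nextT (.sub (.cell aFlow (.var aCur) nextT) (.const 1)) ;;
        setVar aCur nextT ;; emitNode))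
    (fun r τ => τ aNxt = σ aNxt ∧ ∃ (x : G.Node) (P : List G.Node), τ aCur 0 0 = G.code x ∧
      Peel f₀ vis dst a x P (flowOf (τ aFlow)) ∧ (x = G.sink ∨ dst x + r ≤ dst a) ∧
      OutIs τ (L ++ pathCode P))
    ⟨rfl, a, [a], hcur, hf ▸ Peel.init ha, Or.inr le_rfl, hL⟩ ?_
  · obtain ⟨-, x, P, -, hx, hr, hO⟩ := main
    have h₁ := ht.dst_lt_card ha
    rw [card_node] at h₁
    have h₂ := G.nodes_le_length
    obtain rfl := hr.resolve_right (by lia)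
    exact ⟨P, hx, hO⟩
  · rintro r τ hr ⟨hτn, x, P, hx, hA, hd, hO⟩
    have e₁ : ∀ t, t ≠ aRound → τ.set aRound 0 0 r t = τ t := fun t h => Store.set_of_ne _ h _ _ _
    set τ' := τ.set aRound 0 0 r
    have hO' : OutIs τ' (L ++ pathCode P) := hO.congr (e₁ _ (by lia)) (e₁ _ (by lia))
    by_cases hc : (Term.eq (.var aCur) sinkT).Holds G.encode τ'
    · rw [Cmd.exec_ite_pos _ _ hc]
      simp only [Term.holds_eq, Term.eval_var, e₁ aCur (by lia), hx, sinkT_eval, code_inj] at hc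
      exact ⟨(e₁ _ (by lia)).trans hτn, x, P, by rw [Cmd.exec, e₁ _ (by lia), hx],
        by rwa [Cmd.exec, e₁ _ (by lia)], Or.inl hc, hO'⟩
    · rw [Cmd.exec_ite_neg _ _ hc]
      simp only [Term.holds_eq, Term.eval_var, e₁ aCur (by lia), hx, sinkT_eval, code_inj] at hc
      have hn : τ' aNxt (G.code x) 0 = G.code (nxt x) := by
        rw [e₁ _ (by lia), hτn, hnxt x hA.reached hc]
      have hx' : τ' aCur 0 0 = G.code x := by rw [e₁ _ (by lia), hx]
      have hn' : nextT.eval G.encode τ' = G.code (nxt x) := by simp [nextT, hx', hn]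
      rw [Cmd.exec_seq, Cmd.exec_seq, exec_setVar, Cmd.exec_assign]
      simp only [Term.eval_var, Term.eval_sub, Term.eval_cell, Term.eval_const, hx', hn']
      set τ₁ := τ'.set aFlow (G.code x) (G.code (nxt x)) (τ' aFlow (G.code x) (G.code (nxt x)) - 1)
        with hτ₁
      have e₂ : ∀ t, t ≠ aFlow → τ₁ t = τ' t := fun t h => Store.set_of_ne _ h _ _ _
      have hn₁ : nextT.eval G.encode τ₁ = G.code (nxt x) := by
        simp only [nextT, Term.eval_arr, Term.eval_var, e₂ aNxt (by lia), e₂ aCur (by lia), hx', hn]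
      rw [hn₁]
      set τ₂ := τ₁.set aCur 0 0 (G.code (nxt x)) with hτ₂
      have e₃ : ∀ t, t ≠ aCur → τ₂ t = τ₁ t := fun t h => Store.set_of_ne _ h _ _ _
      have hc₂ : τ₂ aCur 0 0 = G.code (nxt x) := by simp [hτ₂, Store.get_set]
      refine ⟨?_, nxt x, P ++ [nxt x], ?_, ?_, ?_, ?_⟩
      · rw [exec_emitNode_of_notMem _ _ (by simp), e₃ _ (by lia), e₂ _ (by lia), e₁ _ (by lia), hτn]
      · rw [exec_emitNode_of_notMem _ _ (by simp), hc₂]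
      · have : flowOf (G := G) (emitNode.exec G.encode τ₂ aFlow) =
            pull (flowOf (τ aFlow)) x (nxt x) := by
          rw [exec_emitNode_of_notMem _ _ (by simp), e₃ _ (by lia), hτ₁]
          funext v w
          rw [flowOf_set, e₁ _ (by lia)]
          rfl
        rw [this]
        exact hA.step ht hc
      · have := (ht.next x hA.reached hc).2.2
        have := hd.resolve_left hc
        exact Or.inr (by lia)
      · have h₂ : OutIs τ₂ (L ++ pathCode P) := hO'.congr
          ((e₃ _ (by lia)).trans (e₂ _ (by lia))) ((e₃ _ (by lia)).trans (e₂ _ (by lia)))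
        have := h₂.emitNode hc₂
        simpa [pathCode] using this

end Instance

end UFCS

/-! # Correctness of the algorithm -/

namespace UFCS

open RAM FlowNet

/-- The best candidate found so far. -/
def bestT : Term := .sub (.var aBest) (.const 1)

/-- The test whether `aJ` is a client not yet considered, of positive utility, and better than the
best candidate found so far. -/
def candidateT : Term :=
  .mul (.mul (.mul (.lt (.var aJ) satT) (clientT (.var aJ) 0)) (.not (.arr aDone (.var aJ))))
    (.mul (.mul (.not (clientT (.var aJ) 2)) (clientT (.var aJ) 3))
      (.add (.not (.var aBest))
        (.lt (.mul (clientT bestT 3) (clientT (.var aJ) 4))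
          (.mul (clientT (.var aJ) 3) (clientT bestT 4)))))

/-- Finds a client of maximum positive utility among those not yet considered. -/
def select : Cmd :=
  setVar aBest (.const 0) ;;
  .loop aJ (.ite candidateT (setVar aBest (.add (.var aJ) (.const 1))) .skip)

/-- Considers one client. -/
def consider : Cmd :=
  setArr aDone bestT (.const 1) ;;
  search residualT ;;
  setVar aCur (sourceT bestT) ;;
  .ite (.arr aVis (.var aCur)) (setArr aAcc bestT (.const 1) ;; augment) .skip

/-- Clients of utility at most zero are never considered, since omitting them cannot lower the
optimum. -/
def greedy : Cmd := .loop aRound (select ;; .ite (.var aBest) consider .skip)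

/-- Writes down the path of the client `aJ`. -/
def outputPath : Cmd :=
  search supportT ;;
  setVar aCur (sourceT (.var aJ)) ;;
  emit (.const 1) ;;
  emit (.add (.arr aDst (.var aCur)) (.const 1)) ;;
  emitNode ;;
  peel

def outputClient : Cmd :=
  .ite (.mul (.lt (.var aJ) satT) (clientT (.var aJ) 0))
    (.ite (.arr aAcc (.var aJ)) outputPath (emit (.const 0))) .skip

def solver : Cmd := .seq greedy (.loop aJ outputClient)

theorem solver_tame : solver.tame = true := by decide

namespace Instance

variable {G : Instance} {σ τ : Store}

theorem clientT_cond {i : Term} {c : G.Client} (h : i.eval G.encode σ = c.1) :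
    (clientT i 0).Holds G.encode σ ∧ ((clientT i 2).Holds G.encode σ ↔ G.u c < 0) ∧
      (clientT i 3).eval G.encode σ = (G.u c).num.natAbs ∧
      (clientT i 4).eval G.encode σ = (G.u c).den := by
  refine ⟨?_, ?_, ?_, ?_⟩
  · rw [Term.Holds, G.clientT_eval h (by lia)]
    exact (G.getD_clientCode_zero _).2 c.2
  · rw [Term.Holds, G.clientT_eval h (by lia)]
    exact G.getD_clientCode_two c
  · rw [G.clientT_eval h (by lia), getD_clientCode_three]
  · rw [G.clientT_eval h (by lia), getD_clientCode_four]

theorem natAbs_mul_lt_iff {a b : ℚ} (ha : 0 < a) (hb : 0 < b) :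
    a.num.natAbs * b.den < b.num.natAbs * a.den ↔ a < b := by
  have h₁ := Rat.num_pos.2 ha
  have h₂ := Rat.num_pos.2 hb
  rw [Rat.lt_iff]
  zify
  rw [abs_of_pos h₁, abs_of_pos h₂]

/-- A client of positive utility that has not yet been considered. -/
def Candidate (σ : Store) (c : G.Client) : Prop := σ aDone c.1 0 = 0 ∧ 0 < G.u c

/-- `aBest` stores a satellite index plus one, with `0` for none. Both utilities compared are
positive, so cross-multiplication of absolute numerators with denominators decides the order. -/
theorem candidateT_holds_iff {c : G.Client} (hJ : σ aJ 0 0 = c.1)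
    (hB : ∀ b, σ aBest 0 0 = b + 1 → ∃ d : G.Client, d.1.val = b ∧ 0 < G.u d) :
    candidateT.Holds G.encode σ ↔ Candidate σ c ∧
      ∀ d : G.Client, σ aBest 0 0 = d.1.val + 1 → G.u d < G.u c := by
  have hJ' : (Term.var aJ).eval G.encode σ = c.1 := hJ
  obtain ⟨h₀, h₂, h₃, h₄⟩ := clientT_cond hJ'
  have h₅ : (clientT (.var aJ) 3).Holds G.encode σ ↔ G.u c ≠ 0 := by
    rw [Term.Holds, h₃]; simp
  simp only [candidateT, Term.holds_mul, Term.holds_lt, satT_eval, hJ', c.1.2, h₀, Term.holds_not,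
    Term.holds_arr, h₂, h₅, Term.holds_add, Term.holds_var, Term.eval_mul, h₃, h₄, true_and,
    Candidate, not_not, not_lt]
  have hpos : 0 ≤ G.u c ∧ G.u c ≠ 0 ↔ 0 < G.u c := by
    rw [lt_iff_le_and_ne]; exact and_congr_right fun _ => ne_comm
  rw [hpos, and_assoc]
  refine and_congr_right fun _ => and_congr_right fun hc => ?_
  rcases Nat.eq_zero_or_pos (σ aBest 0 0) with h | h
  · simp [h]
  · obtain ⟨d, hd, hdu⟩ := hB (σ aBest 0 0 - 1) (by lia)
    have hb : bestT.eval G.encode σ = d.1 := hd.symm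
    obtain ⟨-, -, k₃, k₄⟩ := clientT_cond hb
    rw [k₃, k₄, natAbs_mul_lt_iff hdu hc]
    constructor
    · rintro (h' | h') d' hd'
      · lia
      · obtain rfl : d' = d := Subtype.ext (Fin.ext (by lia))
        exact h'
    · exact fun h' => Or.inr (h' d (by lia))

theorem exec_select_of_notMem (l : List ℕ) (σ : Store) {t : ℕ} (ht : t ∉ [aBest, aJ]) :
    select.exec l σ t = σ t :=
  Cmd.exec_of_notMem _ _ _ (by
    simp only [select, setVar, Cmd.writes, List.mem_cons, List.cons_append, List.nil_append,
      List.not_mem_nil, or_false, not_or] at ht ⊢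
    tauto)

/-- The selected client has the greatest utility among all candidates. -/
theorem exec_select (σ : Store) :
    (select.exec G.encode σ aBest 0 0 = 0 ∧ ∀ c : G.Client, ¬ Candidate σ c) ∨
    ∃ b : G.Client, select.exec G.encode σ aBest 0 0 = b.1.val + 1 ∧ Candidate σ b ∧
      ∀ c : G.Client, Candidate σ c → G.u c ≤ G.u b := by
  have main := Cmd.exec_loop_induction (l := G.encode) (σ := σ.set aBest 0 0 0) (x := aJ)
    (c := .ite candidateT (setVar aBest (.add (.var aJ) (.const 1))) .skip)
    (fun j τ => τ aDone = σ aDone ∧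
      ((τ aBest 0 0 = 0 ∧ ∀ c : G.Client, c.1.val < j → ¬ Candidate σ c) ∨
      ∃ b : G.Client, τ aBest 0 0 = b.1.val + 1 ∧ Candidate σ b ∧
        ∀ c : G.Client, c.1.val < j → Candidate σ c → G.u c ≤ G.u b))
    ⟨Store.set_of_ne _ (by lia) _ _ _, Or.inl ⟨by simp [Store.get_set], by simp⟩⟩ ?_
  · have hI : ∀ c : G.Client, c.1.val < G.encode.length := fun c => by
      have := c.1.2; rw [length_encode]; lia
    rcases main.2 with ⟨h₁, h₂⟩ | ⟨b, h₁, h₂, h₃⟩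
    · exact Or.inl ⟨h₁, fun c => h₂ c (hI c)⟩
    · exact Or.inr ⟨b, h₁, h₂, fun c => h₃ c (hI c)⟩
  · rintro j τ hj ⟨hτ, hB⟩
    have e₁ : ∀ t, t ≠ aJ → τ.set aJ 0 0 j t = τ t := fun t h => Store.set_of_ne _ h _ _ _
    have eJ : τ.set aJ 0 0 j aJ 0 0 = j := by simp [Store.get_set]
    set τ' := τ.set aJ 0 0 j
    rw [← e₁ aBest (by lia)] at hB
    have hD : τ' aDone = σ aDone := (e₁ _ (by lia)).trans hτ
    by_cases hc : ∃ c : G.Client, c.1.val = j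
    · obtain ⟨c, hc⟩ := hc
      have hcand : Candidate τ' c ↔ Candidate σ c := by unfold Candidate; rw [hD]
      have hiff := candidateT_holds_iff (σ := τ') (c := c) (by rw [eJ, hc]) (by
        intro b hb
        rcases hB with h | ⟨d, hd, hd', -⟩
        · lia
        · exact ⟨d, by lia, hd'.2⟩)
      rw [hcand] at hiff
      by_cases hh : candidateT.Holds G.encode τ'
      · rw [Cmd.exec_ite_pos _ _ hh, exec_setVar]
        obtain ⟨h₁, h₂⟩ := hiff.1 hh
        refine ⟨by rw [Store.set_of_ne _ (by lia), hD], Or.inr ⟨c, ?_, h₁, fun d hd hd' => ?_⟩⟩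
        · simp [Store.get_set, eJ, hc]
        · rcases Nat.lt_succ_iff_lt_or_eq.1 hd with hd | hd
          · rcases hB with ⟨-, h⟩ | ⟨b, hb, -, hb'⟩
            · exact absurd hd' (h d hd)
            · exact (hb' d hd hd').trans (h₂ b hb).le
          · obtain rfl : d = c := Subtype.ext (Fin.ext (by lia))
            exact le_rfl
      · rw [Cmd.exec_ite_neg _ _ hh]
        refine ⟨hD, ?_⟩
        rw [hiff] at hh
        have hj : ∀ d : G.Client, d.1.val < j + 1 → d.1.val < j ∨ d = c := fun d hd =>
          (Nat.lt_succ_iff_lt_or_eq.1 hd).imp_right fun h => Subtype.ext (Fin.ext (by lia))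
        rcases hB with ⟨h₁, h₂⟩ | ⟨b, hb, h₁, h₂⟩
        · refine Or.inl ⟨h₁, fun d hd hd' => ?_⟩
          rcases hj d hd with hd | rfl
          · exact h₂ d hd hd'
          · exact hh ⟨hd', fun d' hd' => by lia⟩
        · refine Or.inr ⟨b, hb, h₁, fun d hd hd' => ?_⟩
          rcases hj d hd with hd | rfl
          · exact h₂ d hd hd'
          · by_contra hlt
            refine hh ⟨hd', fun d' hdb => ?_⟩
            obtain rfl : d' = b := Subtype.ext (Fin.ext (by lia))
            exact not_le.1 hlt
    · have hh : ¬ candidateT.Holds G.encode τ' := by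
        intro hh
        simp only [candidateT, Term.holds_mul, Term.holds_lt, satT_eval, Term.eval_var, eJ] at hh
        have hjI := hh.1.1.1
        have h₀ := hh.1.1.2
        rw [Term.Holds, G.clientT_eval (σ := τ') (i := .var aJ) (j := ⟨j, hjI⟩) eJ (by lia),
          getD_clientCode_zero] at h₀
        exact hc ⟨⟨⟨j, hjI⟩, h₀⟩, rfl⟩
      rw [Cmd.exec_ite_neg _ _ hh]
      have hj : ∀ d : G.Client, d.1.val < j + 1 → d.1.val < j := fun d hd =>
        (Nat.lt_succ_iff_lt_or_eq.1 hd).resolve_right fun h => hc ⟨d, h⟩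
      refine ⟨hD, ?_⟩
      rcases hB with ⟨h₁, h₂⟩ | ⟨b, hb, h₁, h₂⟩
      · exact Or.inl ⟨h₁, fun d hd => h₂ d (hj d hd)⟩
      · exact Or.inr ⟨b, hb, h₁, fun d hd => h₂ d (hj d hd)⟩

/-! ### The greedy loop realises the abstract selection -/

/-- The clients with a nonzero entry in an array. -/
def marked (A : ℕ → ℕ → ℕ) : Finset G.Client := {c | A c.1 0 ≠ 0}

theorem mem_marked {A : ℕ → ℕ → ℕ} {c : G.Client} : c ∈ marked A ↔ A c.1 0 ≠ 0 := by
  simp [marked]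

theorem marked_set (σ : Store) (t : ℕ) (c : G.Client) :
    marked (G := G) (σ.set t c.1 0 1 t) = insert c (marked (σ t)) := by
  ext d
  simp only [mem_marked, Finset.mem_insert, Store.get_set, true_and, and_true]
  by_cases h : d = c
  · simp [h]
  · have : ¬ d.1.val = c.1.val := fun e => h (Subtype.ext (Fin.ext e))
    simp [h, this]

/-- The state of the greedy selection is stored in `σ`. -/
def GreedyState (G : Instance) (σ : Store) : Prop :=
  Greedy G.ucap G.sink G.source G.u (marked (σ aDone)) (marked (σ aAcc)) (flowOf (σ aFlow))

theorem exec_consider {b : G.Client} (h : GreedyState G σ) (hb : σ aBest 0 0 = b.1.val + 1)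
    (hcand : Candidate σ b) (hmax : ∀ d ∈ marked (σ aDone), G.u b ≤ G.u d) :
    GreedyState G (consider.exec G.encode σ) ∧
      marked (G := G) (consider.exec G.encode σ aDone) = insert b (marked (σ aDone)) := by
  have hbD : b ∉ marked (σ aDone) := by simpa [mem_marked] using hcand.1
  simp only [consider, Cmd.exec_seq]
  have hb₀ : bestT.eval G.encode σ = b.1 := by simp [bestT, hb]
  rw [exec_setArr, hb₀, Term.eval_const]
  set σ₁ := σ.set aDone b.1 0 1 with hσ₁
  have f₁ : ∀ t, t ≠ aDone → σ₁ t = σ t := fun t h => Store.set_of_ne _ h _ _ _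
  have hD₁ : marked (G := G) (σ₁ aDone) = insert b (marked (σ aDone)) := marked_set _ _ _
  obtain ⟨ht, hcode⟩ := isTree_search (G := G) (e := residualT)
    (B := Residual G.ucap (flowOf (σ aFlow))) σ₁ (fun τ v w hF hv hw => by
      rw [residualT_holds hv hw, hF, f₁ _ (by lia)])
  have f₂ : ∀ t ∉ [aVis, aNxt, aDst, aX, aY, aRound],
      (search residualT).exec G.encode σ₁ t = σ₁ t := fun t => search_of_notMem _ _ _
  set σ₂ := (search residualT).exec G.encode σ₁
  have hb₂ : bestT.eval G.encode σ₂ = b.1 := by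
    simp [bestT, f₂ aBest (by simp), f₁ aBest (by lia), hb]
  rw [exec_setVar, G.sourceT_eval hb₂]
  set σ₃ := σ₂.set aCur 0 0 (G.code (G.source b)) with hσ₃
  have f₃ : ∀ t, t ≠ aCur → σ₃ t = σ₂ t := fun t h => Store.set_of_ne _ h _ _ _
  have hc₃ : σ₃ aCur 0 0 = G.code (G.source b) := by simp [hσ₃, Store.get_set]
  have hF₃ : σ₃ aFlow = σ aFlow := by rw [f₃ _ (by lia), f₂ _ (by simp), f₁ _ (by lia)]
  have hA₃ : σ₃ aAcc = σ aAcc := by rw [f₃ _ (by lia), f₂ _ (by simp), f₁ _ (by lia)]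
  have hD₃ : marked (G := G) (σ₃ aDone) = insert b (marked (σ aDone)) := by
    rw [f₃ _ (by lia), f₂ _ (by simp), hD₁]
  have hholds : (Term.arr aVis (.var aCur)).Holds G.encode σ₃ ↔ vis σ₂ (G.source b) := by
    rw [Term.holds_arr, Term.eval_var, hc₃, f₃ _ (by lia)]; rfl
  by_cases hv : vis σ₂ (G.source b)
  · rw [Cmd.exec_ite_pos _ _ (hholds.2 hv), Cmd.exec_seq, exec_setArr]
    have hb₃ : bestT.eval G.encode σ₃ = b.1 := by
      simp [bestT, f₃ aBest (by lia), f₂ aBest (by simp), f₁ aBest (by lia), hb]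
    rw [hb₃, Term.eval_const]
    set σ₄ := σ₃.set aAcc b.1 0 1 with hσ₄
    have f₄ : ∀ t, t ≠ aAcc → σ₄ t = σ₃ t := fun t h => Store.set_of_ne _ h _ _ _
    have hA₄ : marked (G := G) (σ₄ aAcc) = insert b (marked (σ aAcc)) := by
      rw [hσ₄, marked_set, hA₃]
    have haug := exec_augment ht σ₄ (fun v hv hvs => by
      rw [f₄ _ (by lia), f₃ _ (by lia), hcode v hv hvs]) (a := G.source b)
      (by rw [f₄ _ (by lia), hc₃]) hv (by rw [f₄ _ (by lia), hF₃]) h.le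
    have f₅ : ∀ t ∉ [aRound, aFlow, aCur], augment.exec G.encode σ₄ t = σ₄ t := fun t ht =>
      Cmd.exec_of_notMem _ _ _ (by
        simpa [augment, pushNext, setVar, Cmd.writes] using ht)
    have hD₅ : marked (G := G) (augment.exec G.encode σ₄ aDone) = insert b (marked (σ aDone)) := by
      rw [f₅ _ (by simp), f₄ _ (by lia), hD₃]
    refine ⟨?_, hD₅⟩
    unfold GreedyState
    rw [hD₅, f₅ aAcc (by simp), hA₄]
    exact Greedy.accept h hbD hcand.2.le hmax ht haug
  · rw [Cmd.exec_ite_neg _ _ (mt hholds.1 hv), Cmd.exec]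
    refine ⟨?_, hD₃⟩
    unfold GreedyState
    rw [hD₃, hA₃, hF₃]
    exact Greedy.reject h hbD hcand.2.le hmax ht hv

/-- The greedy phase accepts a set of clients of maximum utility. -/
theorem exec_greedy (G : Instance) :
    GreedyState G (greedy.exec G.encode fun _ _ _ => 0) ∧
      ∀ c : G.Client, c ∈ marked (greedy.exec G.encode (fun _ _ _ => 0) aDone) ↔ 0 < G.u c := by
  -- The third clause records the decreasing order that `Greedy.step` requires. By the fourth, each
  -- round with a candidate left considers a new client, and there are fewer clients than rounds.
  have main := Cmd.exec_loop_induction (l := G.encode) (σ := fun _ _ _ => 0) (x := aRound)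
    (c := select ;; .ite (.var aBest) consider .skip)
    (fun r τ => GreedyState G τ ∧ (∀ c ∈ marked (τ aDone), 0 < G.u c) ∧
      (∀ c ∈ marked (τ aDone), ∀ d, Candidate τ d → G.u d ≤ G.u c) ∧
      ((∀ c : G.Client, ¬ Candidate τ c) ∨ r ≤ (marked (G := G) (τ aDone)).card))
    ⟨?_, by simp [mem_marked], by simp [mem_marked], Or.inr (Nat.zero_le _)⟩ ?_
  · obtain ⟨h₁, h₂, -, h₃⟩ := main
    refine ⟨h₁, fun c => ⟨h₂ c, fun hc => ?_⟩⟩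
    have h₄ := h₃.resolve_right fun h => by
      have h₅ := Finset.card_le_univ (marked (G := G)
        ((Cmd.loop aRound (select ;; .ite (.var aBest) consider .skip)).exec G.encode
          (fun _ _ _ => 0) aDone))
      have h₆ : Fintype.card G.Client ≤ G.I := by
        simpa using Finset.card_le_univ G.C
      have := G.length_encode
      lia
    have := h₄ c
    simp only [Candidate, not_and] at this
    exact mem_marked.2 fun h => this h hc
  · have : ∀ t, marked (G := G) ((fun _ _ _ => 0 : Store) t) = ∅ := fun t => by
      ext c; simp [mem_marked]
    unfold GreedyState
    rw [this aDone]
    exact Greedy.init _ _ _ _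
  · rintro r τ hr ⟨h₁, h₂, h₃, h₄⟩
    rw [Cmd.exec_seq]
    set τ' := select.exec G.encode (τ.set aRound 0 0 r) with hτ'
    have f : ∀ t, t ∉ [aBest, aJ, aRound] → τ' t = τ t := fun t ht => by
      rw [hτ', exec_select_of_notMem _ _ (by simp at ht ⊢; tauto),
        Store.set_of_ne _ (by simp at ht; tauto)]
    have hcand : ∀ c : G.Client, Candidate (τ.set aRound 0 0 r) c ↔ Candidate τ c := fun c => by
      unfold Candidate; rw [Store.set_of_ne _ (by lia)]
    have hcand' : ∀ c : G.Client, Candidate τ' c ↔ Candidate τ c := fun c => by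
      unfold Candidate; rw [f _ (by simp)]
    have h₁' : GreedyState G τ' := by
      unfold GreedyState; rw [f _ (by simp), f _ (by simp), f _ (by simp)]; exact h₁
    have hD : τ' aDone = τ aDone := f _ (by simp)
    rcases exec_select (G := G) (τ.set aRound 0 0 r) with ⟨hB, hno⟩ | ⟨b, hB, hb, hmax⟩
    · rw [Cmd.exec_ite_neg _ _ (by rw [Term.holds_var, not_not]; exact hB), Cmd.exec]
      simp only [hcand] at hno
      refine ⟨h₁', by rwa [hD], ?_, Or.inl ?_⟩
      · simp only [hD, hcand']; exact h₃
      · simp only [hcand']; exact hno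
    · rw [Cmd.exec_ite_pos _ _ (by rw [Term.holds_var]; exact hB.trans_ne (Nat.succ_ne_zero _))]
      simp only [hcand] at hb hmax
      obtain ⟨k₁, k₂⟩ := exec_consider h₁' hB ((hcand' b).2 hb)
        (fun d hd => h₃ d (by rwa [hD] at hd) b hb)
      set τ'' := consider.exec G.encode τ'
      rw [hD] at k₂
      have hbD : b ∉ marked (τ aDone) := by simpa [mem_marked] using hb.1
      have hc'' : ∀ c : G.Client, Candidate τ'' c → Candidate τ c := fun c hc => by
        refine ⟨?_, hc.2⟩
        have : c ∉ marked (τ'' aDone) := by simpa [mem_marked] using hc.1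
        rw [k₂, Finset.mem_insert, not_or] at this
        simpa [mem_marked] using this.2
      refine ⟨k₁, ?_, ?_, ?_⟩
      · rw [k₂]
        intro c hc
        rcases Finset.mem_insert.1 hc with rfl | hc
        · exact hb.2
        · exact h₂ c hc
      · rw [k₂]
        intro c hc d hd
        rcases Finset.mem_insert.1 hc with rfl | hc
        · exact hmax d (hc'' d hd)
        · exact h₃ c hc d (hc'' d hd)
      · rcases h₄ with h₄ | h₄
        · exact absurd hb (h₄ b)
        · refine Or.inr ?_
          rw [k₂, Finset.card_insert_of_notMem hbD]
          lia

end Instance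

end UFCS

/-! # Output of the routing -/

namespace UFCS

open RAM FlowNet

namespace Instance

variable {G : Instance} {σ τ : Store}

theorem exec_of_notMem_of_subset {c : Cmd} {L : List ℕ} (l : List ℕ) (σ : Store)
    (h : ∀ s ∈ c.writes, s ∈ L) {t : ℕ} (ht : t ∉ L) : c.exec l σ t = σ t :=
  Cmd.exec_of_notMem _ _ _ (mt (h t) ht)

theorem peel_writes : ∀ s ∈ peel.writes, s ∈ [aRound, aFlow, aCur, aOut, aOutLen] := by decide

/-- The output arrays are numbered below `aFlow`, so they are still empty when the output phase
begins. -/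
theorem le_of_mem_greedy_writes : ∀ s ∈ greedy.writes, aFlow ≤ s := by decide

/-- The code of the decision on a single satellite. -/
def decisionCode (R : G.Routing) (i : Fin G.I) : List ℕ :=
  if h : i ∈ G.C then
    match R ⟨i, h⟩ with
    | none => [0]
    | some P => 1 :: P.length :: pathCode P
  else []

def prefixCode (R : G.Routing) (j : ℕ) : List ℕ :=
  ((List.finRange G.I).take j).flatMap (decisionCode R)

theorem prefixCode_eq_encodeRouting (R : G.Routing) {j : ℕ} (hj : G.I ≤ j) :
    prefixCode R j = G.encodeRouting R := by
  rw [prefixCode, List.take_of_length_le (by simpa using hj)]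
  rfl

theorem prefixCode_succ (R : G.Routing) (i : Fin G.I) :
    prefixCode R (i + 1) = prefixCode R i ++ decisionCode R i := by
  unfold prefixCode
  rw [List.take_succ_eq_append_getElem (by simp), List.flatMap_append]
  simp

theorem prefixCode_succ_of_le (R : G.Routing) {j : ℕ} (hj : G.I ≤ j) :
    prefixCode R (j + 1) = prefixCode R j := by
  rw [prefixCode_eq_encodeRouting R hj, prefixCode_eq_encodeRouting R (by lia)]

theorem prefixCode_congr {R R' : G.Routing} {j : ℕ} (h : ∀ c : G.Client, c.1.val < j → R c = R' c) :
    prefixCode R j = prefixCode R' j := by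
  refine List.flatMap_congr fun i hi => ?_
  obtain ⟨k, hk, rfl⟩ := List.mem_take_iff_getElem.1 hi
  have hkj : k < j := by lia
  unfold decisionCode
  split
  · next hC => rw [h ⟨_, hC⟩ (by simpa using hkj)]
  · rfl

theorem length_pathCode (P : List G.Node) : (pathCode P).length = P.length * 2 := by
  simp [pathCode, List.length_flatMap]

/-- A simple path has at most `I * K` nodes, so each satellite contributes at most `2 + 2 * I * K`
numbers, and the capacity table with its `3 * K * I * I` entries outweighs the paths. This is why
copying as many cells as the input has suffices. -/
theorem length_encodeRouting_le {R : G.Routing} (hR : ∀ c, ∀ P ∈ R c, P.Nodup) :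
    (G.encodeRouting R).length ≤ G.encode.length := by
  have hd : ∀ i, (decisionCode R i).length ≤ 2 + G.I * G.K * 2 := by
    intro i
    unfold decisionCode
    split
    · next hC =>
      split
      · simp only [List.length_singleton]; lia
      · next P hP =>
        have := (hR ⟨i, hC⟩ P hP).length_le_card
        rw [card_node] at this
        simp only [List.length_cons, length_pathCode]
        lia
    · simp
  have h : (G.encodeRouting R).length ≤ G.I * (2 + G.I * G.K * 2) := by
    rw [← prefixCode_eq_encodeRouting R le_rfl, prefixCode, List.take_of_length_le (by simp),
      List.length_flatMap]
    refine (List.sum_le_card_nsmul _ (2 + G.I * G.K * 2) ?_).trans (by simp)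
    intro x hx
    obtain ⟨i, -, rfl⟩ := List.mem_map.1 hx
    exact hd i
  refine h.trans ?_
  rw [length_encode]
  have : G.I * (2 + G.I * G.K * 2) = 2 * G.I + 2 * (G.K * G.I * G.I) := by ring
  lia

theorem usage_update {R : G.Routing} {c : G.Client} (hc : R c = none) (P : List G.Node)
    (v w : G.Node) :
    G.usage (Function.update R c (some P)) v w =
      G.usage R v w + if [v, w] <:+: P then 1 else 0 := by
  classical
  unfold usage
  split_ifs with h
  · rw [← Finset.card_insert_of_notMem (a := c)]
    · refine congrArg Finset.card (Finset.ext fun d => ?_)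
      simp only [Finset.mem_filter, Finset.mem_univ, true_and, Finset.mem_insert]
      by_cases hd : d = c
      · subst hd; simp [h]
      · simp [hd]
    · simp [hc]
  · rw [add_zero]
    refine congrArg Finset.card (Finset.ext fun d => ?_)
    simp only [Finset.mem_filter, Finset.mem_univ, true_and]
    by_cases hd : d = c
    · subst hd; simp [h, hc]
    · simp [Function.update_of_ne hd]

/-- The state of the output phase after the satellites below `j`: the routing `R` of the clients
in `S` below `j` has been written down, and the flow left in `σ` serves the other clients. -/
structure OutputState (S : Finset G.Client) (j : ℕ) (R : G.Routing) (σ : Store) : Prop where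
  acc : marked (σ aAcc) = S
  selected : ∀ c : G.Client, (R c).isSome ↔ c ∈ S ∧ c.1.val < j
  isPath : ∀ c, ∀ P ∈ R c, G.IsPath (G.source c) G.sink P
  le : ∀ v w, flowOf (σ aFlow) v w + G.usage R v w ≤ G.ucap v w
  flow : IsFlow G.sink G.source {c ∈ S | j ≤ c.1.val} (flowOf (σ aFlow))
  out : OutIs σ (prefixCode R j)

theorem OutputState.congr {S : Finset G.Client} {j : ℕ} {R : G.Routing}
    (h : OutputState S j R σ) (hτ : ∀ t ∈ [aAcc, aFlow, aOut, aOutLen], τ t = σ t) :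
    OutputState S j R τ := by
  refine ⟨?_, h.selected, h.isPath, ?_, ?_, h.out.congr (hτ _ (by simp)) (hτ _ (by simp))⟩
  · rw [hτ _ (by simp)]; exact h.acc
  · rw [hτ _ (by simp)]; exact h.le
  · rw [hτ _ (by simp)]; exact h.flow

/-- Peeling moves one unit per arc of the path from the stored flow to the usage, so their sum keeps
respecting the capacities, and the remaining flow serves the later clients. -/
theorem OutputState.outputPath {S : Finset G.Client} {c : G.Client} {R : G.Routing}
    (h : OutputState S c.1.val R σ) (hc : c ∈ S) (hJ : σ aJ 0 0 = c.1) :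
    ∃ R', OutputState S (c.1.val + 1) R' (outputPath.exec G.encode σ) := by
  have hRc : R c = none := by
    rw [← Option.not_isSome_iff_eq_none, h.selected]; lia
  simp only [UFCS.outputPath, Cmd.exec_seq]
  obtain ⟨ht, hcode⟩ := isTree_search (G := G) (e := supportT)
    (B := fun v w => 0 < flowOf (σ aFlow) v w) σ (fun τ v w hF hv hw => by
      rw [supportT_holds hv hw, hF])
  have f₁ : ∀ t ∉ [aVis, aNxt, aDst, aX, aY, aRound],
      (search supportT).exec G.encode σ t = σ t := fun t => search_of_notMem _ _ _
  set σ₁ := (search supportT).exec G.encode σ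
  have hJ₁ : (Term.var aJ).eval G.encode σ₁ = c.1 := by
    rw [Term.eval_var, f₁ _ (by simp), hJ]
  rw [exec_setVar, G.sourceT_eval hJ₁]
  set σ₂ := σ₁.set aCur 0 0 (G.code (G.source c)) with hσ₂
  have f₂ : ∀ t, t ≠ aCur → σ₂ t = σ₁ t := fun t h => Store.set_of_ne _ h _ _ _
  have hc₂ : σ₂ aCur 0 0 = G.code (G.source c) := by simp [hσ₂, Store.get_set]
  have hvis : vis σ₁ (G.source c) :=
    h.flow.vis_of_mem ht (Finset.mem_filter.2 ⟨hc, le_rfl⟩)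
  have out₂ : OutIs σ₂ (prefixCode R c.1) := h.out.congr
    ((f₂ _ (by lia)).trans (f₁ _ (by simp))) ((f₂ _ (by lia)).trans (f₁ _ (by simp)))
  have out₃ := out₂.emit (l := G.encode) (.const 1)
  have f₃ : ∀ t ∉ [aOut, aOutLen], (emit (.const 1)).exec G.encode σ₂ t = σ₂ t := fun t =>
    exec_emit_of_notMem _ _ _
  set σ₃ := (emit (.const 1)).exec G.encode σ₂
  have out₄ := out₃.emit (l := G.encode) (.add (.arr aDst (.var aCur)) (.const 1))
  have f₄ : ∀ t ∉ [aOut, aOutLen],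
      (emit (.add (.arr aDst (.var aCur)) (.const 1))).exec G.encode σ₃ t = σ₃ t := fun t =>
    exec_emit_of_notMem _ _ _
  -- The number of nodes is emitted before the walk; a tree path has one node more than its
  -- distance, which `Peel.length` confirms afterwards.
  have hdst : (Term.add (.arr aDst (.var aCur)) (.const 1)).eval G.encode σ₃ =
      dst σ₁ (G.source c) + 1 := by
    rw [Term.eval_add, Term.eval_arr, Term.eval_var, f₃ _ (by simp), f₃ _ (by simp), hc₂,
      f₂ _ (by lia)]
    rfl
  rw [hdst] at out₄
  set σ₄ := (emit (.add (.arr aDst (.var aCur)) (.const 1))).exec G.encode σ₃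
  have hc₄ : σ₄ aCur 0 0 = G.code (G.source c) := by rw [f₄ _ (by simp), f₃ _ (by simp), hc₂]
  have out₅ := out₄.emitNode hc₄
  have f₅ : ∀ t ∉ [aOut, aOutLen], emitNode.exec G.encode σ₄ t = σ₄ t := fun t =>
    exec_emitNode_of_notMem _ _
  set σ₅ := emitNode.exec G.encode σ₄
  have f : ∀ t ∉ [aOut, aOutLen, aCur], σ₅ t = σ₁ t := fun t ht => by
    simp only [List.mem_cons, List.not_mem_nil, or_false, not_or] at ht
    rw [f₅ _ (by simp [ht]), f₄ _ (by simp [ht]), f₃ _ (by simp [ht]), f₂ _ ht.2.2]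
  obtain ⟨P, hP, hout⟩ := exec_peel ht σ₅
    (fun v hv hvs => by rw [f _ (by simp), hcode v hv hvs]) (by rw [f₅ _ (by simp), hc₄]) hvis
    (by rw [f _ (by simp), f₁ _ (by simp)]) out₅
  have f₆ : ∀ t ∉ [aRound, aFlow, aCur, aOut, aOutLen], peel.exec G.encode σ₅ t = σ₅ t :=
    fun t ht => exec_of_notMem_of_subset G.encode σ₅ peel_writes ht
  set σ₆ := peel.exec G.encode σ₅
  refine ⟨Function.update R c (some P), ?_, fun d => ?_, fun d Q hQ => ?_, fun v w => ?_,
    fun v hv => ?_, ?_⟩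
  · rw [f₆ _ (by simp), f _ (by simp), f₁ _ (by simp), h.acc]
  · by_cases hd : d = c
    · subst hd; simp [hc]
    · have : d.1.val ≠ c.1.val := fun e => hd (Subtype.ext (Fin.ext e))
      rw [Function.update_of_ne hd, h.selected]
      refine and_congr_right fun _ => ?_
      lia
  · by_cases hd : d = c
    · subst hd
      simp only [Function.update_self, Option.mem_def, Option.some.injEq] at hQ
      subst hQ
      refine ⟨hP.head, hP.last, hP.pairwise.imp fun hlt e => ?_, hP.chain.imp fun v w hvw => ?_⟩
      · rw [e] at hlt; exact lt_irrefl _ hlt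
      -- Arcs of the path carry flow, hence have positive integral capacity, hence exist.
      · exact G.isArc_of_ucap_pos (hvw.trans_le (le_trans (Nat.le_add_right _ _) (h.le v w)))
    · rw [Function.update_of_ne hd] at hQ
      exact h.isPath d Q hQ
  · rw [usage_update hRc]
    have h₁ := h.le v w
    have h₂ := hP.use v w
    lia
  · have hS : ({d ∈ S | c.1.val ≤ d.1.val} : Finset G.Client) =
        insert c ({d ∈ S | c.1.val + 1 ≤ d.1.val} : Finset G.Client) := by
      ext d
      simp only [Finset.mem_filter, Finset.mem_insert]
      by_cases hd : d = c
      · subst hd; simp [hc]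
      · have : d.1.val ≠ c.1.val := fun e => hd (Subtype.ext (Fin.ext e))
        simp only [hd, false_or]
        refine and_congr_right fun _ => ?_
        lia
    have h₁ := h.flow v hv
    rw [hS, demand_insert _ (by simp)] at h₁
    rw [hP.net, h₁, if_neg hv]
    push_cast
    ring
  · rw [prefixCode_succ, prefixCode_congr (R' := R)]
    · have hlen := hP.length
      rw [ht.dst_root] at hlen
      have hdc : decisionCode (Function.update R c (some P)) c.1 =
          1 :: P.length :: pathCode P := by
        simp [decisionCode, c.2]
      rw [hdc, show P.length = dst σ₁ (G.source c) + 1 by lia]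
      simpa using hout
    · intro d hd
      rw [Function.update_of_ne (by rintro rfl; exact lt_irrefl _ hd)]

/-- Skipping a satellite that is not a selected client. -/
theorem OutputState.skip {S : Finset G.Client} {j : ℕ} {R : G.Routing}
    (h : OutputState S j R σ) (hj : ∀ c ∈ S, c.1.val ≠ j)
    (hacc : τ aAcc = σ aAcc) (hflow : τ aFlow = σ aFlow) (hout : OutIs τ (prefixCode R (j + 1))) :
    OutputState S (j + 1) R τ := by
  refine ⟨by rw [hacc, h.acc], fun c => ?_, h.isPath, by rw [hflow]; exact h.le, ?_, hout⟩
  · rw [h.selected]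
    refine and_congr_right fun hc => ?_
    have := hj c hc
    lia
  · rw [hflow]
    convert h.flow using 1
    refine Finset.filter_congr fun c hc => ?_
    have := hj c hc
    lia

theorem OutputState.outputClient {S : Finset G.Client} {j : ℕ} {R : G.Routing}
    (h : OutputState S j R σ) (hJ : σ aJ 0 0 = j) :
    ∃ R', OutputState S (j + 1) R' (outputClient.exec G.encode σ) := by
  have hJ' : (Term.var aJ).eval G.encode σ = j := hJ
  by_cases hc : ∃ c : G.Client, c.1.val = j
  · obtain ⟨c, rfl⟩ := hc
    have hcond : (Term.mul (.lt (.var aJ) satT) (clientT (.var aJ) 0)).Holds G.encode σ := by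
      simp only [Term.holds_mul, Term.holds_lt, satT_eval, hJ']
      exact ⟨c.1.2, (clientT_cond hJ').1⟩
    rw [UFCS.outputClient, Cmd.exec_ite_pos _ _ hcond]
    have hacc : (Term.arr aAcc (.var aJ)).Holds G.encode σ ↔ c ∈ S := by
      rw [Term.holds_arr, hJ', ← h.acc, mem_marked]
    by_cases hcS : c ∈ S
    · rw [Cmd.exec_ite_pos _ _ (hacc.2 hcS)]
      exact h.outputPath hcS hJ
    · rw [Cmd.exec_ite_neg _ _ (mt hacc.1 hcS)]
      refine ⟨R, h.skip (fun d hd e => hcS ?_)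
        (exec_emit_of_notMem _ _ _ (by simp)) (exec_emit_of_notMem _ _ _ (by simp)) ?_⟩
      · rwa [← show d = c from Subtype.ext (Fin.ext e)]
      · have hRc : R c = none := by
          rw [← Option.not_isSome_iff_eq_none, h.selected]
          exact fun h' => hcS h'.1
        have hdc : decisionCode R c.1 = [0] := by simp [decisionCode, c.2, hRc]
        rw [prefixCode_succ, hdc]
        exact h.out.emit (.const 0)
  · have hcond : ¬ (Term.mul (.lt (.var aJ) satT) (clientT (.var aJ) 0)).Holds G.encode σ := by
      simp only [Term.holds_mul, Term.holds_lt, satT_eval, hJ', not_and]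
      intro hjI h₀
      rw [Term.Holds, G.clientT_eval (j := ⟨j, hjI⟩) hJ' (by lia), getD_clientCode_zero] at h₀
      exact hc ⟨⟨⟨j, hjI⟩, h₀⟩, rfl⟩
    rw [UFCS.outputClient, Cmd.exec_ite_neg _ _ hcond, Cmd.exec]
    refine ⟨R, h.skip (fun d _ e => hc ⟨d, e⟩) rfl rfl ?_⟩
    by_cases hjI : j < G.I
    · have hdc : decisionCode R ⟨j, hjI⟩ = [] := by
        rw [decisionCode, dif_neg]
        exact fun hC => hc ⟨⟨⟨j, hjI⟩, hC⟩, rfl⟩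
      have := prefixCode_succ R ⟨j, hjI⟩
      rw [hdc, List.append_nil] at this
      rw [this]
      exact h.out
    · rw [prefixCode_succ_of_le R (by lia)]
      exact h.out

theorem solver_correct (G : Instance) : ∃ R : G.Routing, G.Optimal R ∧
    OutIs (solver.exec G.encode fun _ _ _ => 0) (G.encodeRouting R) := by
  obtain ⟨hg, hD⟩ := exec_greedy G
  rw [solver, Cmd.exec_seq]
  have hout : ∀ t < aFlow, greedy.exec G.encode (fun _ _ _ => 0) t = fun _ _ => 0 :=
    fun t ht => by
      rw [Cmd.exec_of_notMem greedy G.encode (fun _ _ _ => 0)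
        fun h => ht.not_ge (le_of_mem_greedy_writes t h)]
  generalize greedy.exec G.encode (fun _ _ _ => 0) = σ at *
  have hu₀ : ∀ v w, G.usage (fun _ => none) v w = 0 := fun v w => by simp [usage]
  have main := Cmd.exec_loop_induction (l := G.encode) (σ := σ) (x := aJ) (c := outputClient)
    (fun j τ => ∃ R, OutputState (marked (σ aAcc)) j R τ)
    ⟨fun _ => none, rfl, by simp, by simp, fun v w => by rw [hu₀]; exact hg.le v w, ?_, ?_⟩ ?_
  · obtain ⟨R, hR⟩ := main
    have hI : G.I ≤ G.encode.length := by rw [length_encode]; lia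
    have hsel : ∀ c, (R c).isSome ↔ c ∈ marked (σ aAcc) := fun c => by
      rw [hR.selected, and_iff_left (c.1.2.trans_le hI)]
    refine ⟨R, ⟨⟨hR.isPath, fun v w p hp => G.le_of_usage_le_ucap hp ?_⟩, fun R' hR' => ?_⟩, ?_⟩
    · exact (Nat.le_add_left _ _).trans (hR.le v w)
    · have hsum : ∀ Q : G.Routing, G.utility Q =
          ∑ c ∈ ({c | (Q c).isSome} : Finset G.Client), G.u c := fun Q => by
        rw [utility, Finset.sum_filter]
      have hS : ({c | (R c).isSome} : Finset G.Client) = marked (σ aAcc) := by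
        ext c; simp [hsel]
      rw [hsum, hsum, hS]
      -- The considered clients are exactly those of positive utility, and the selection of any
      -- feasible `R'` respects all cuts.
      refine hg.sum_le (fun c hc => ((hD c).1 hc).le) (fun c hc => not_lt.1 (mt (hD c).2 hc)) ?_
      convert hR'.cutCond using 1
    · have := hR.out
      rwa [prefixCode_eq_encodeRouting R hI] at this
  · have : ({c ∈ marked (σ aAcc) | 0 ≤ c.1.val} : Finset G.Client) = marked (σ aAcc) := by simp
    rw [this]
    exact hg.flow
  · simp [OutIs, prefixCode, hout]
  · rintro j τ hj ⟨R, hR⟩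
    exact (hR.congr fun t ht => Store.set_of_ne _ (by
      simp only [List.mem_cons, List.not_mem_nil, or_false] at ht; lia) _ _ _).outputClient
      (by simp [Store.get_set])

end Instance

end UFCS

/-- 1-UF-CS is solvable in polynomial time: an optimal client selection, together with its routing,
can be computed in polynomial time. -/
theorem mainTheorem9 :
    RAM.PolyTimeSolvable UFCS.Instance.encode UFCS.Instance.encodeRouting
      UFCS.Instance.Optimal := by
  refine RAM.polyTimeSolvable_of_cmd UFCS.solver UFCS.solver_tame 0 1 fun G => ?_
  obtain ⟨R, hR, h₁, h₂⟩ := UFCS.Instance.solver_correct G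
  exact ⟨R, hR, UFCS.Instance.length_encodeRouting_le fun c P hP => (hR.1.1 c P hP).2.2.1, h₁, h₂⟩
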